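/- Let $n\ge 1$ be an integer, $0<s<1$ and $m\in\mathbb R$. For a measurable function $a$ on $\mathbb R^n$ of at most polynomial growth and $f\in\mathcal S(\mathbb R^n)$ put $$a(D)f(x)=\frac1{(2\pi)^n}\int_{\mathbb R^n}e^{ix\cdot\xi}a(\xi)\widehat f(\xi)\,d\xi,\qquad \widehat f(\xi)=\int_{\mathbb R^n}e^{-i\xi\cdot x}f(x)\,dx .$$ Thus $e^{i|D|^s}$ has symbol $e^{i|\xi|^s}$, and $e^{i|D|^s}\chi(2^{-j}D)$ has symbol $e^{i|\xi|^s}\chi(2^{-j}\xi)$. Let $\theta,\phi\in C_0^\infty(\mathbb R^n)$ satisfy $$\theta=1 \text{ on } \{1/8\le|\xi|\le 8\},\quad \operatorname{supp}\theta\subset\{1/10\le|\xi|\le 10\},\qquad \phi=1\text{ on }\{|\xi|\le 2\},\quad \operatorname{supp}\phi\subset\{|\xi|\le 3\}.$$ Let $\|h\|_{h^1}=\big\|\sup_{0<t<1}|\Phi_t*h|\big\|_{L^1}$ be the norm of the local Hardy space $h^1$, where $\Phi\in\mathcal S(\mathbb R^n)$ is any fixed function with $\int\Phi\neq0$ and $\Phi_t(x)=t^{-n}\Phi(x/t)$.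 Suppose that there is a constant $c$ such that $$2^{jm}\big\|e^{i|D|^s}f\cdot e^{i|D|^s}\phi(2^{-j}D)g\cdot e^{i|D|^s}\theta(2^{-j}D)h\big\|_{L^1}\le c\,\|f\|_{L^\infty}\|g\|_{L^\infty}\|h\|_{h^1}$$ for all $j\in\{1,2,3,\dots\}$ and all $f,g,h\in\mathcal S(\mathbb R^n)$. Then $$m\le m_s=-\frac{ns}2-ns(1-s).$$ -/

import Mathlib

open MeasureTheory
open scoped NNReal ENNReal ContDiff

noncomputable section

namespace OscillatoryMultiplier

/-- The Fourier transform `∫ e^{-i ξ·x} f(x) dx` (no `2π` in the exponent). -/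
def fourierHat {n : ℕ} (f : EuclideanSpace ℝ (Fin n) → ℂ) (ξ : EuclideanSpace ℝ (Fin n)) : ℂ :=
  ∫ x, Complex.exp (-(Complex.I * (inner ℝ ξ x : ℝ))) * f x

/-- The Fourier multiplier operator
`a(D) f (x) = (2π)^{-n} ∫ e^{i x·ξ} a(ξ) (fourierHat f)(ξ) dξ`. -/
def multiplierOp {n : ℕ} (a f : EuclideanSpace ℝ (Fin n) → ℂ) (x : EuclideanSpace ℝ (Fin n)) : ℂ :=
  ((2 * (Real.pi : ℂ)) ^ n)⁻¹ *
    ∫ ξ, Complex.exp (Complex.I * (inner ℝ x ξ : ℝ)) * a ξ * fourierHat f ξ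

/-- The symbol `e^{i |ξ|^s}`. -/
def phase {n : ℕ} (s : ℝ) (ξ : EuclideanSpace ℝ (Fin n)) : ℂ :=
  Complex.exp (Complex.I * ((‖ξ‖ ^ s : ℝ) : ℂ))

/-- The symbol `χ(2^{-j} ξ)`. -/
def dyadicDilate {n : ℕ} (j : ℕ) (χ : EuclideanSpace ℝ (Fin n) → ℂ)
    (ξ : EuclideanSpace ℝ (Fin n)) : ℂ :=
  χ (((2 : ℝ) ^ j)⁻¹ • ξ)

/-- The convolution `(Φ_t * h)(x)` with `Φ_t(y) = t^{-n} Φ(y / t)`. -/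
def dilatedConv {n : ℕ} (Φ h : EuclideanSpace ℝ (Fin n) → ℂ) (t : ℝ)
    (x : EuclideanSpace ℝ (Fin n)) : ℂ :=
  ∫ y, ((t ^ n)⁻¹ : ℝ) * Φ (t⁻¹ • (x - y)) * h y

/-- The norm `‖ sup_{0<t<1} |Φ_t * h| ‖_{L^1}` of the local Hardy space `h^1`. For every Schwartz
function `Φ` with nonzero integral it is a norm on `h^1`; different choices of `Φ` give equivalent
norms. -/
def localHardyNorm {n : ℕ} (Φ h : EuclideanSpace ℝ (Fin n) → ℂ) : ℝ≥0∞ :=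
  ∫⁻ x, ⨆ t ∈ Set.Ioo (0 : ℝ) 1, ‖dilatedConv Φ h t x‖ₑ

end OscillatoryMultiplier

end

namespace OscillatoryMultiplier

/-! The estimate is tested on wave packets built from one bump `χ` near a unit vector, with `R = 2 ^
j` and `r` comparable to `R ^ (1 - s)`. Take `f = g` with Fourier transform `e^{-i|ξ|^s} χ(ξ/r)`.
The operator undoes the phase and focuses `f` to size `r ^ n` on the ball of radius `1/(2r)`,
whereas dispersion at time `r ^ s` spreads `f` itself out: its supremum is at most a constant times
`r ^ n * r ^ (-sn/2)`. Take `h` with Fourier transform `χ(ξ/R)`. Its `h^1` norm is bounded in `R`,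
while `e^{i|D|^s} h` has `L^1` norm at least a constant times `R ^ (sn/2)` on the ball of radius `B
* R ^ (s - 1)`. The choice of `r` makes this radius equal to `1/(2r)`, so all three factors are
large on the same ball. The estimate then gives `R ^ m * r ^ (2n) * R ^ (sn/2) ≲ r ^ (2n) * r ^
(-sn)`, that is, `R ^ (m + sn/2 + (1-s)sn)` stays bounded as `j` grows, so the exponent is not
positive.

Three analytic facts carry this: the dispersive bound (`exists_bump_dispersive`), the lower `L^1`
bound (`exists_setIntegral_invTransform_phaseBump_ge`), obtained from Plancherel, a second moment
and the dispersive bound, and the uniform Hardy bound (`exists_localHardyNorm_dilate_le`), obtained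
from cancellation. -/

theorem contDiff_of_forall_mem_tsupport {X F : Type*} [NormedAddCommGroup X] [NormedSpace ℝ X]
    [NormedAddCommGroup F] [NormedSpace ℝ F] {k : WithTop ℕ∞} {f : X → F}
    (hf : ∀ x ∈ tsupport f, ContDiffAt ℝ k f x) : ContDiff ℝ k f := by
  refine contDiff_iff_contDiffAt.2 fun x => ?_
  by_cases hx : x ∈ tsupport f
  · exact hf x hx
  · exact contDiffAt_const.congr_of_eventuallyEq (notMem_tsupport_iff_eventuallyEq.1 hx)

/-! ### Nonstationary phase with parameters. -/

theorem integral_fderiv_apply_eq_zero {E : Type*} [NormedAddCommGroup E] [InnerProductSpace ℝ E]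
    [FiniteDimensional ℝ E] [MeasurableSpace E] [BorelSpace E] {u : E → ℂ}
    (hu : ContDiff ℝ ∞ u) (hc : HasCompactSupport u) (v : E) :
    ∫ x, fderiv ℝ u x v = 0 := by
  have hi : Integrable u := hu.continuous.integrable_of_hasCompactSupport hc
  have hi' : Integrable (fun x => fderiv ℝ u x v) :=
    Continuous.integrable_of_hasCompactSupport
      ((hu.continuous_fderiv (by simp)).clm_apply continuous_const) (hc.fderiv_apply ℝ v)
  have h := integral_mul_fderiv_eq_neg_fderiv_mul_of_integrable (μ := (volume : Measure E))
    (𝕜 := ℂ) (f := fun _ : E => (1 : ℂ)) (g := u) (v := v) (by simp) (by simpa using hi')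
    (by simpa using hi) (by simp)
    (fun x _ => hu.differentiable (by simp) x)
  simpa using h

/-- Nonstationary phase, uniformly in a parameter: repeated integration by parts along the
direction `v p`. -/
theorem exists_norm_integral_exp_mul_le {P E : Type*} [NormedAddCommGroup P] [NormedSpace ℝ P]
    [NormedAddCommGroup E] [InnerProductSpace ℝ E]
    [FiniteDimensional ℝ E] [MeasurableSpace E] [BorelSpace E]
    {W : Set (P × E)} (hW : IsOpen W) {Ψ : P × E → ℝ} (hΨ : ContDiffOn ℝ ∞ Ψ W)
    {v : P → E} (hv : ContDiff ℝ ∞ v) (hne : ∀ q ∈ W, fderiv ℝ Ψ q (0, v q.1) ≠ 0) (N : ℕ) :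
    ∀ a : P × E → ℂ, ContDiff ℝ ∞ a → HasCompactSupport a → tsupport a ⊆ W →
      ∃ C : ℝ, ∀ p : P, ∀ μ : ℝ, 0 < μ →
        ‖∫ ξ, Complex.exp (Complex.I * ((μ * Ψ (p, ξ) : ℝ) : ℂ)) * a (p, ξ)‖ ≤ C * (μ ^ N)⁻¹ := by
  induction N with
  | zero =>
    intro a ha hc _
    obtain ⟨B, hB⟩ := hc.exists_bound_of_continuous ha.continuous
    set S : Set E := Prod.snd '' tsupport a with hS
    have hSc : IsCompact S := hc.isCompact.image continuous_snd
    refine ⟨B * (volume S).toReal, fun p μ _ => ?_⟩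
    have hz : ∀ ξ, ξ ∉ S → Complex.exp (Complex.I * ((μ * Ψ (p, ξ) : ℝ) : ℂ)) * a (p, ξ) = 0 := by
      intro ξ hξ
      have : (p, ξ) ∉ tsupport a := fun h => hξ ⟨_, h, rfl⟩
      simp [image_eq_zero_of_notMem_tsupport this]
    rw [← setIntegral_eq_integral_of_forall_compl_eq_zero hz]
    simp only [pow_zero, inv_one, mul_one]
    refine norm_setIntegral_le_of_norm_le_const hSc.measure_lt_top fun ξ _ => ?_
    rw [norm_mul, mul_comm Complex.I, Complex.norm_exp_ofReal_mul_I, one_mul]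
    exact hB _
  | succ N ih =>
    intro a ha hc hs
    have hD : ContDiffOn ℝ ∞ (fun q => fderiv ℝ Ψ q (0, v q.1)) W :=
      (hΨ.fderiv_of_isOpen hW (by simp)).clm_apply (by fun_prop)
    set D : P × E → ℂ := fun q => ((fderiv ℝ Ψ q (0, v q.1) : ℝ) : ℂ) with hDdef
    have hDW : ∀ q ∈ W, ContDiffAt ℝ ∞ D q := fun q hq =>
      Complex.ofRealCLM.contDiff.contDiffAt.comp q (hD.contDiffAt (hW.mem_nhds hq))
    -- Dividing by the derivative of the phase along `v` makes `∂_v (e^{iμΨ} g) = e^{iμΨ} (iμ a +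
    -- b)` with `b = ∂_v g`. The left side integrates to zero, so one factor `μ⁻¹` is gained and `b`
    -- replaces `a`.
    set g : P × E → ℂ := fun q => a q * (D q)⁻¹ with hgdef
    have hgs : tsupport g ⊆ tsupport a := closure_mono fun q hq => by
      simp only [hgdef, Function.mem_support, ne_eq, mul_eq_zero, not_or] at hq
      exact hq.1
    have hg : ContDiff ℝ ∞ g := contDiff_of_forall_mem_tsupport fun q hq =>
      ha.contDiffAt.mul ((hDW q (hs (hgs hq))).inv (by simpa [hDdef] using hne q (hs (hgs hq))))
    have hgc : HasCompactSupport g := hc.mono' (subset_closure.trans hgs)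
    set b : P × E → ℂ := fun q => fderiv ℝ g q (0, v q.1) with hbdef
    have hb : ContDiff ℝ ∞ b := (hg.fderiv_right (by simp)).clm_apply (by fun_prop)
    have hbs : tsupport b ⊆ tsupport g :=
      (closure_mono fun q hq => by
        simp only [hbdef, Function.mem_support, ne_eq] at hq ⊢
        intro h; apply hq; simp [h]).trans (tsupport_fderiv_subset ℝ)
    have hbc : HasCompactSupport b := hgc.mono' (subset_closure.trans hbs)
    obtain ⟨C, hC⟩ := ih b hb hbc (hbs.trans (hgs.trans hs))
    refine ⟨C, fun p μ hμ => ?_⟩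
    set U : P × E → ℂ := fun q => Complex.exp (Complex.I * ((μ * Ψ q : ℝ) : ℂ)) * g q with hUdef
    have hΨat : ∀ q ∈ W, ContDiffAt ℝ ∞ Ψ q := fun q hq => hΨ.contDiffAt (hW.mem_nhds hq)
    have hexp : ∀ q ∈ W, ContDiffAt ℝ ∞
        (fun q => Complex.exp (Complex.I * ((μ * Ψ q : ℝ) : ℂ))) q := fun q hq => by
      have h1 : ContDiffAt ℝ ∞ (fun q => ((μ * Ψ q : ℝ) : ℂ)) q :=
        Complex.ofRealCLM.contDiff.contDiffAt.comp q (contDiffAt_const.mul (hΨat q hq))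
      exact (contDiffAt_const.mul h1).cexp
    have hUs : tsupport U ⊆ tsupport g := closure_mono fun q hq => by
      simp only [hUdef, Function.mem_support, ne_eq, mul_eq_zero, not_or] at hq
      exact hq.2
    have hU : ContDiff ℝ ∞ U := contDiff_of_forall_mem_tsupport fun q hq =>
      (hexp q (hs (hgs (hUs hq)))).mul hg.contDiffAt
    have hder : ∀ q, fderiv ℝ U q (0, v q.1) =
        Complex.exp (Complex.I * ((μ * Ψ q : ℝ) : ℂ)) * (Complex.I * μ * a q + b q) := by
      intro q
      by_cases hq : q ∈ tsupport g
      · have hqW := hs (hgs hq)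
        have h1 : HasFDerivAt (fun q => Complex.exp (Complex.I * ((μ * Ψ q : ℝ) : ℂ))) _ q :=
          ((Complex.ofRealCLM.hasFDerivAt.comp q
            (((hΨat q hqW).differentiableAt (by simp)).hasFDerivAt.const_mul μ)).const_mul
              Complex.I).cexp
        have h2 := (hg.differentiable (by simp) q).hasFDerivAt
        have h3 := (h1.mul h2).fderiv
        have hDne : D q ≠ 0 := by simpa [hDdef] using hne q hqW
        have h4 : a q = g q * D q := by simp [hgdef, hDne]
        change fderiv ℝ (fun q => Complex.exp (Complex.I * ((μ * Ψ q : ℝ) : ℂ)) * g q) q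
          (0, v q.1) = _
        erw [h3]
        rw [h4]
        simp only [hbdef, hDdef]
        simp
        ring
      · have h1 : fderiv ℝ U q = 0 := by
          by_contra h
          exact hq (hUs (tsupport_fderiv_subset ℝ (subset_closure h)))
        have h2 : b q = 0 := image_eq_zero_of_notMem_tsupport fun h => hq (hbs h)
        have h3 : a q = 0 := by
          by_contra h
          have hqW := hs (subset_closure h)
          exact hq (subset_closure (by
            simpa [hgdef, hDdef, h] using hne q hqW))
        simp [h1, h2, h3]
    have hslice : ContDiff ℝ ∞ (fun ξ : E => U (p, ξ)) := hU.comp (by fun_prop)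
    have hcs : ∀ {f : P × E → ℂ}, HasCompactSupport f → HasCompactSupport (fun ξ => f (p, ξ)) :=
      fun {f} hf => HasCompactSupport.intro (hf.isCompact.image continuous_snd) fun ξ hξ =>
        image_eq_zero_of_notMem_tsupport fun h => hξ ⟨_, h, rfl⟩
    have hz := integral_fderiv_apply_eq_zero hslice
      (hcs (hgc.mono' (subset_closure.trans hUs))) (v p)
    have hsl : ∀ ξ, fderiv ℝ (fun ξ : E => U (p, ξ)) ξ (v p) = fderiv ℝ U (p, ξ) (0, v p) := by
      intro ξ
      have h := ((hU.differentiable (by simp) (p, ξ)).hasFDerivAt.comp ξ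
        (hasFDerivAt_prodMk_right (𝕜 := ℝ) p ξ)).fderiv
      change fderiv ℝ (U ∘ fun ξ : E => (p, ξ)) ξ (v p) = _
      rw [h]; simp
    have hint : ∀ {f : P × E → ℂ}, ContDiff ℝ ∞ f → HasCompactSupport f → tsupport f ⊆ W →
        Integrable (fun ξ => Complex.exp (Complex.I * ((μ * Ψ (p, ξ) : ℝ) : ℂ)) * f (p, ξ)) := by
      intro f hf hfc hfW
      have h1 : ContDiff ℝ ∞
          (fun q => Complex.exp (Complex.I * ((μ * Ψ q : ℝ) : ℂ)) * f q) :=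
        contDiff_of_forall_mem_tsupport fun q hq => (hexp q (hfW (closure_mono (fun q hq => by
          simp only [Function.mem_support, ne_eq, mul_eq_zero, not_or] at hq
          exact hq.2) hq))).mul hf.contDiffAt
      exact Continuous.integrable_of_hasCompactSupport
        (h1.continuous.comp (by fun_prop : Continuous fun ξ : E => (p, ξ))) (hcs hfc).mul_left
    simp only [hsl] at hz
    have hz2 : ∫ ξ, (Complex.I * μ * (Complex.exp (Complex.I * ((μ * Ψ (p, ξ) : ℝ) : ℂ)) * a (p, ξ))
        + Complex.exp (Complex.I * ((μ * Ψ (p, ξ) : ℝ) : ℂ)) * b (p, ξ)) = 0 := by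
      rw [← hz]
      refine integral_congr_ae (Filter.Eventually.of_forall fun ξ => ?_)
      simp only [hder (p, ξ)]
      ring
    rw [integral_add ((hint ha hc hs).const_mul _) (hint hb hbc (hbs.trans (hgs.trans hs))),
      integral_const_mul, add_eq_zero_iff_eq_neg] at hz2
    have hn := congrArg norm hz2
    rw [norm_mul, norm_neg, norm_mul, Complex.norm_I, one_mul, Complex.norm_real,
      Real.norm_of_nonneg hμ.le] at hn
    have h5 := hC p μ hμ
    rw [← hn] at h5
    rw [pow_succ, mul_inv, ← mul_assoc, ← div_eq_mul_inv _ μ, le_div_iff₀ hμ]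
    linarith

/-! ### Smooth difference quotients of `‖ξ‖ ^ s`. -/

/-- The divided difference `((1 + y) ^ (s / 2) - 1) / y`, extended smoothly to `y = 0`. -/
noncomputable def rpowSlope (s y : ℝ) : ℝ := dslope (fun y : ℝ => (1 + y) ^ (s / 2)) 0 y

theorem mul_rpowSlope (s y : ℝ) : y * rpowSlope s y = (1 + y) ^ (s / 2) - 1 := by
  have := sub_smul_dslope (fun y : ℝ => (1 + y) ^ (s / 2)) 0 y
  simpa [rpowSlope] using this

theorem rpowSlope_zero (s : ℝ) : rpowSlope s 0 = s / 2 := by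
  have h : HasDerivAt (fun y : ℝ => (1 + y) ^ (s / 2)) (s / 2) 0 := by
    have h1 : HasDerivAt (fun y : ℝ => 1 + y) 1 0 := (hasDerivAt_id 0).const_add 1
    simpa using h1.rpow_const (p := s / 2) (by simp)
  rw [rpowSlope, dslope_same, h.deriv]

/-- Only `y = 0` is delicate: there the power is analytic, and the divided difference of an analytic
function is again analytic. -/
theorem contDiffAt_rpowSlope (s : ℝ) {y : ℝ} (hy : -1 < y) : ContDiffAt ℝ ∞ (rpowSlope s) y := by
  rcases eq_or_ne y 0 with rfl | h0
  · have h : AnalyticAt ℝ (fun y : ℝ => (1 + y) ^ (s / 2)) 0 := by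
      have h1 : AnalyticAt ℝ (fun y : ℝ => Real.exp (Real.log (1 + y) * (s / 2))) 0 :=
        (((analyticAt_const.add analyticAt_id).log (by simp)).mul analyticAt_const).rexp
      refine h1.congr ?_
      filter_upwards [lt_mem_nhds hy] with y hy
      rw [Real.rpow_def_of_pos (by linarith)]
    obtain ⟨p, hp⟩ := h
    exact AnalyticAt.contDiffAt ⟨_, hp.has_fpower_series_dslope_fslope⟩
  · have h : ContDiffAt ℝ ∞ (fun y : ℝ => ((1 + y) ^ (s / 2) - 1) / y) y :=
      (((contDiffAt_const.add contDiffAt_id).rpow_const_of_ne (by simp; linarith)).sub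
        contDiffAt_const).div contDiffAt_id h0
    refine h.congr_of_eventuallyEq ?_
    filter_upwards [isOpen_ne.mem_nhds h0] with y hy
    rw [← mul_rpowSlope, mul_div_cancel_left₀ _ hy]

section PhaseSlope

variable {E : Type*} [NormedAddCommGroup E] [InnerProductSpace ℝ E]

/-- The relative increment `(‖ξ + r w‖² - ‖ξ‖²) / (r ‖ξ‖²)` at `q = ((w, r), ξ)`. -/
noncomputable def relIncrement (q : (E × ℝ) × E) : ℝ :=
  (2 * inner ℝ q.2 q.1.1 + q.1.2 * ‖q.1.1‖ ^ 2) / ‖q.2‖ ^ 2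

/-- The difference quotient `(‖ξ + r w‖ ^ s - ‖ξ‖ ^ s) / r` at `q = ((w, r), ξ)`, extended smoothly
to `r = 0`. -/
noncomputable def phaseSlope (s : ℝ) (q : (E × ℝ) × E) : ℝ :=
  (‖q.2‖ ^ 2) ^ (s / 2) * relIncrement q * rpowSlope s (q.1.2 * relIncrement q)

theorem sq_norm_rpow_half {E : Type*} [NormedAddCommGroup E] (s : ℝ) (x : E) : (‖x‖ ^ 2) ^ (s / 2) = ‖x‖ ^ s := by
  rw [← Real.rpow_natCast ‖x‖ 2, ← Real.rpow_mul (norm_nonneg x)]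
  congr 1; push_cast; ring

/-- With `r = ‖η‖` and `w = η / ‖η‖`, this extracts the factor `‖η‖` from the phase of the
autocorrelation. The remaining phase is smooth up to `r = 0`, which makes estimates uniform for
small `η`. -/
theorem mul_phaseSlope (s r : ℝ) (w : E) {ξ : E} (hξ : ξ ≠ 0) :
    r * phaseSlope s ((w, r), ξ) = ‖ξ + r • w‖ ^ s - ‖ξ‖ ^ s := by
  have hp : 0 < ‖ξ‖ ^ 2 := by positivity
  have h1 : 1 + r * relIncrement ((w, r), ξ) = ‖ξ + r • w‖ ^ 2 / ‖ξ‖ ^ 2 := by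
    rw [relIncrement, @norm_add_sq_real, norm_smul, mul_pow, inner_smul_right, Real.norm_eq_abs,
      sq_abs]
    field_simp
    ring
  have h2 := mul_rpowSlope s (r * relIncrement ((w, r), ξ))
  rw [h1, Real.div_rpow (by positivity) hp.le, sq_norm_rpow_half, sq_norm_rpow_half] at h2
  have h3 : 0 < ‖ξ‖ ^ s := Real.rpow_pos_of_pos (norm_pos_iff.2 hξ) s
  calc r * phaseSlope s ((w, r), ξ) = ‖ξ‖ ^ s * (r * relIncrement ((w, r), ξ) *
        rpowSlope s (r * relIncrement ((w, r), ξ))) := by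
        rw [phaseSlope, sq_norm_rpow_half]; ring
    _ = _ := by rw [h2]; field_simp

/-- An open set on which `phaseSlope` is smooth. -/
noncomputable def phaseSlopeDomain (E : Type*) [NormedAddCommGroup E] [InnerProductSpace ℝ E] :
    Set ((E × ℝ) × E) :=
  {q | q.2 ≠ 0 ∧ -1 < q.1.2 * relIncrement q}

theorem contDiffAt_relIncrement {q : (E × ℝ) × E} (hq : q.2 ≠ 0) :
    ContDiffAt ℝ ∞ relIncrement q := by
  unfold relIncrement
  refine ContDiffAt.div ?_ ?_ (by positivity)
  · refine ContDiff.contDiffAt ?_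
    exact (contDiff_const.mul (contDiff_snd.inner ℝ (contDiff_fst.comp contDiff_fst))).add
      ((contDiff_snd.comp contDiff_fst).mul ((contDiff_fst.comp contDiff_fst).norm_sq ℝ))
  · exact (contDiff_snd.norm_sq ℝ).contDiffAt

theorem isOpen_phaseSlopeDomain : IsOpen (phaseSlopeDomain E) := by
  rw [isOpen_iff_mem_nhds]
  rintro q ⟨h1, h2⟩
  have h3 : ContinuousAt (fun q : (E × ℝ) × E => q.1.2 * relIncrement q) q :=
    ContinuousAt.mul (by fun_prop) (contDiffAt_relIncrement h1).continuousAt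
  have h4 : ContinuousAt (fun q : (E × ℝ) × E => q.2) q := by fun_prop
  exact (h4.eventually (isOpen_ne.mem_nhds h1)).and (h3.eventually (lt_mem_nhds h2))

theorem contDiffOn_phaseSlope (s : ℝ) :
    ContDiffOn ℝ ∞ (phaseSlope s) (phaseSlopeDomain E) := by
  rintro q ⟨h1, h2⟩
  refine ContDiffAt.contDiffWithinAt ?_
  have h3 := contDiffAt_relIncrement h1
  unfold phaseSlope
  refine ((ContDiffAt.rpow_const_of_ne (contDiff_snd.norm_sq ℝ).contDiffAt (by positivity)).mul
    h3).mul ?_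
  exact (contDiffAt_rpowSlope s h2).comp q
    (ContDiffAt.mul (contDiff_snd.comp contDiff_fst).contDiffAt h3)

/-- The reflection of `w` in the hyperplane orthogonal to the unit vector `e`. -/
noncomputable def reflectDir (e w : E) : E := w - (2 * inner ℝ e w) • e

theorem contDiff_reflectDir (e : E) : ContDiff ℝ ∞ (reflectDir e) :=
  contDiff_id.sub ((contDiff_const.mul (contDiff_const.inner ℝ contDiff_id)).smul contDiff_const)

/-- At `r = 0` the slope is the derivative of `‖·‖ ^ s` along `w`, so this evaluates the Hessian at
`e` on `w` and its reflection. The Hessian acts as `s` on the complement of `e` and as `s (s - 1)`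
along `e`. For `0 < s < 1` these have opposite signs, and the reflection turns the indefinite form
into a definite one. -/
theorem fderiv_phaseSlope_reflectDir (s : ℝ) {e : E} (he : ‖e‖ = 1) (w : E) :
    fderiv ℝ (phaseSlope s) ((w, 0), e) (0, reflectDir e w) =
      s * (‖w‖ ^ 2 - s * (inner ℝ e w) ^ 2) := by
  have he0 : e ≠ 0 := by rintro rfl; simp at he
  have hmem : ((w, 0), e) ∈ phaseSlopeDomain E := ⟨he0, by simp⟩
  have hdiff : DifferentiableAt ℝ (phaseSlope s) ((w, (0 : ℝ)), e) :=
    ((contDiffOn_phaseSlope s).contDiffAt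
      (isOpen_phaseSlopeDomain.mem_nhds hmem)).differentiableAt (by simp)
  set v := reflectDir e w with hv
  have hline : HasDerivAt (fun t : ℝ => (((w, (0 : ℝ)), e + t • v) : (E × ℝ) × E)) (0, v) 0 := by
    have h1 : HasDerivAt (fun t : ℝ => e + t • v) v 0 := by
      simpa using ((hasDerivAt_id (0 : ℝ)).smul_const v).const_add e
    exact (hasDerivAt_const (0 : ℝ) (w, (0 : ℝ))).prodMk h1
  have hcomp : HasDerivAt (fun t : ℝ => phaseSlope s ((w, 0), e + t • v))
      (fderiv ℝ (phaseSlope s) ((w, 0), e) (0, v)) 0 := by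
    have h1 : HasFDerivAt (phaseSlope s) (fderiv ℝ (phaseSlope s) ((w, 0), e))
        (((w, (0 : ℝ)), e + (0 : ℝ) • v) : (E × ℝ) × E) := by simpa using hdiff.hasFDerivAt
    exact h1.comp_hasDerivAt (0 : ℝ) hline
  have hin : inner ℝ e e = (1 : ℝ) := by rw [real_inner_self_eq_norm_sq, he]; norm_num
  have hev : inner ℝ e v = - inner ℝ e w := by
    rw [hv, reflectDir, inner_sub_right, inner_smul_right, hin]; ring
  have hvw : inner ℝ v w = ‖w‖ ^ 2 - 2 * (inner ℝ e w) ^ 2 := by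
    rw [hv, reflectDir, inner_sub_left, real_inner_smul_left, real_inner_self_eq_norm_sq]; ring
  have hlin : HasDerivAt (fun t : ℝ => e + t • v) v 0 := by
    simpa using ((hasDerivAt_id (0 : ℝ)).smul_const v).const_add e
  have hn : HasDerivAt (fun t : ℝ => ‖e + t • v‖ ^ 2) (2 * inner ℝ e v) 0 := by
    simpa using hlin.norm_sq
  have hi : HasDerivAt (fun t : ℝ => 2 * inner ℝ (e + t • v) w) (2 * inner ℝ v w) 0 := by
    simpa using (hlin.inner ℝ (hasDerivAt_const (0 : ℝ) w)).const_mul 2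
  have hn0 : ‖e + (0 : ℝ) • v‖ ^ 2 = 1 := by simp [he]
  have hp := ((hn.rpow_const (p := s / 2) (by simp [he])).mul
    (hi.div hn (by simp [he]))).mul_const (s / 2)
  have heq : (fun t : ℝ => phaseSlope s ((w, 0), e + t • v)) = fun t =>
      (((fun t : ℝ => (‖e + t • v‖ ^ 2) ^ (s / 2)) *
        ((fun t : ℝ => 2 * inner ℝ (e + t • v) w) / (fun t : ℝ => ‖e + t • v‖ ^ 2))) t) *
        (s / 2) := by
    funext t
    simp [phaseSlope, relIncrement, rpowSlope_zero]
  rw [heq] at hcomp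
  rw [hcomp.unique hp]
  simp [he, hev, hvw]
  ring

theorem fderiv_phaseSlope_reflectDir_pos {s : ℝ} (hs0 : 0 < s) (hs1 : s < 1) {e : E}
    (he : ‖e‖ = 1) {w : E} (hw : w ≠ 0) :
    0 < fderiv ℝ (phaseSlope s) ((w, 0), e) (0, reflectDir e w) := by
  rw [fderiv_phaseSlope_reflectDir s he]
  have h1 : (inner ℝ e w) ^ 2 ≤ ‖w‖ ^ 2 := by
    have := abs_real_inner_le_norm e w
    rw [he, one_mul] at this
    exact sq_le_sq' (neg_le_of_abs_le this) (le_of_abs_le this)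
  have h2 : 0 < ‖w‖ ^ 2 := by positivity
  refine mul_pos hs0 ?_
  nlinarith

end PhaseSlope

/-! ### The dispersive estimate, by way of autocorrelations. -/

section Dispersive

variable {E : Type*} [NormedAddCommGroup E] [InnerProductSpace ℝ E]
  [FiniteDimensional ℝ E] [MeasurableSpace E] [BorelSpace E]

/-- Expand `|∫ u|²` as a double integral, translate one variable and use Fubini. This replaces
stationary phase: only nonstationary bounds on the autocorrelation are needed afterwards. -/
theorem norm_integral_sq_le_integral_norm_autocorrelation {u : E → ℂ} (hu : Continuous u)
    (hc : HasCompactSupport u) :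
    ‖∫ x, u x‖ ^ 2 ≤ ∫ y, ‖∫ x, u (x + y) * (starRingEnd ℂ) (u x)‖ := by
  have hint : Integrable (fun p : E × E => u (p.1 + p.2) * (starRingEnd ℂ) (u p.1))
      (volume.prod volume) := by
    refine Continuous.integrable_of_hasCompactSupport ?_ ?_
    · exact (hu.comp (by fun_prop)).mul (Complex.continuous_conj.comp (hu.comp continuous_fst))
    · refine HasCompactSupport.intro
        (hc.isCompact.prod
          ((hc.isCompact.prod hc.isCompact).image continuous_sub)) fun p hp => ?_
      by_contra h
      obtain ⟨h1, h2⟩ := mul_ne_zero_iff.1 h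
      have h3 : p.1 ∈ tsupport u := subset_closure (by simpa using h2)
      have h4 : p.1 + p.2 ∈ tsupport u := subset_closure h1
      exact hp ⟨h3, (p.1 + p.2, p.1), ⟨h4, h3⟩, by simp⟩
  have h1 : ((‖∫ x, u x‖ ^ 2 : ℝ) : ℂ) = ∫ y, ∫ x, u (x + y) * (starRingEnd ℂ) (u x) := by
    rw [← integral_integral_swap hint, ← Complex.normSq_eq_norm_sq, ← Complex.mul_conj,
      ← integral_conj, ← integral_const_mul]
    refine integral_congr_ae (Filter.Eventually.of_forall fun x => ?_)
    simp only
    rw [integral_mul_const, integral_add_left_eq_self (fun y => u y) x]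
  have h2 := norm_integral_le_integral_norm (μ := (volume : Measure E))
    (fun y => ∫ x, u (x + y) * (starRingEnd ℂ) (u x))
  rw [← h1, Complex.norm_real, Real.norm_of_nonneg (by positivity)] at h2
  exact h2

theorem le_mul_one_add_rpow_neg {A C₀ C₁ t : ℝ} (N : ℕ) (ht : 0 < t) (h0 : A ≤ C₀)
    (h1 : A ≤ C₁ * (t ^ N)⁻¹) (hC₀ : 0 ≤ C₀) (hC₁ : 0 ≤ C₁) :
    A ≤ 2 ^ N * (C₀ + C₁) * (1 + t) ^ (-(N : ℝ)) := by
  rw [Real.rpow_neg (by positivity), Real.rpow_natCast, ← div_eq_mul_inv,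
    le_div_iff₀ (by positivity)]
  rcases le_total t 1 with h | h
  · calc A * (1 + t) ^ N ≤ C₀ * (1 + t) ^ N := by gcongr
      _ ≤ C₀ * 2 ^ N := by gcongr; linarith
      _ ≤ _ := by nlinarith [pow_pos (two_pos : (0 : ℝ) < 2) N]
  · have h2 : (1 + t) ^ N ≤ (2 * t) ^ N := by gcongr; linarith
    calc A * (1 + t) ^ N ≤ C₁ * (t ^ N)⁻¹ * (1 + t) ^ N := by gcongr
      _ ≤ C₁ * (t ^ N)⁻¹ * (2 * t) ^ N := by gcongr
      _ = C₁ * 2 ^ N := by rw [mul_pow]; field_simp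
      _ ≤ _ := by nlinarith [pow_pos (two_pos : (0 : ℝ) < 2) N]

/-- Nondegeneracy holds on the compact set `r = 0`, `ξ = e`, `1/2 ≤ ‖w‖ ≤ 2`, hence on a whole
thickening of it by openness. -/
theorem exists_isCompact_subset_nonstationary {E : Type*} [NormedAddCommGroup E]
    [InnerProductSpace ℝ E] [FiniteDimensional ℝ E] {s : ℝ} (hs0 : 0 < s) (hs1 : s < 1) {e : E}
    (he : ‖e‖ = 1) :
    ∃ W : Set ((E × ℝ) × E), IsOpen W ∧ ContDiffOn ℝ ∞ (phaseSlope s) W ∧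
      (∀ q ∈ W, fderiv ℝ (phaseSlope s) q (0, reflectDir e q.1.1) ≠ 0) ∧
      ∃ ε : ℝ, 0 < ε ∧ ({w : E | 1 / 2 ≤ ‖w‖ ∧ ‖w‖ ≤ 2} ×ˢ Set.Icc (-ε) ε) ×ˢ
        Metric.closedBall e ε ⊆ W := by
  have hcont : ContinuousOn (fun q : (E × ℝ) × E =>
      fderiv ℝ (phaseSlope s) q (0, reflectDir e q.1.1)) (phaseSlopeDomain E) := by
    refine (((contDiffOn_phaseSlope s).fderiv_of_isOpen (m := ∞) isOpen_phaseSlopeDomain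
      (by simp)).continuousOn).clm_apply ?_
    exact (continuous_const.prodMk ((contDiff_reflectDir e).continuous.comp
      (by fun_prop))).continuousOn
  set W : Set ((E × ℝ) × E) := phaseSlopeDomain E ∩
    (fun q => fderiv ℝ (phaseSlope s) q (0, reflectDir e q.1.1)) ⁻¹' {0}ᶜ with hW
  have hWo : IsOpen W := hcont.isOpen_inter_preimage isOpen_phaseSlopeDomain isOpen_compl_singleton
  have hann : IsCompact {w : E | 1 / 2 ≤ ‖w‖ ∧ ‖w‖ ≤ 2} := by
    refine (isCompact_closedBall (0 : E) 2).of_isClosed_subset ?_ fun w hw => by simpa using hw.2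
    exact (isClosed_le continuous_const continuous_norm).inter
      (isClosed_le continuous_norm continuous_const)
  have hK : IsCompact (({w : E | 1 / 2 ≤ ‖w‖ ∧ ‖w‖ ≤ 2} ×ˢ {(0 : ℝ)}) ×ˢ {e}) :=
    (hann.prod isCompact_singleton).prod isCompact_singleton
  have hKW : ({w : E | 1 / 2 ≤ ‖w‖ ∧ ‖w‖ ≤ 2} ×ˢ {(0 : ℝ)}) ×ˢ {e} ⊆ W := by
    rintro ⟨⟨w, r⟩, ξ⟩ ⟨⟨hw, hr⟩, hξ⟩
    obtain rfl : r = 0 := hr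
    obtain rfl : ξ = e := hξ
    refine ⟨⟨by rintro rfl; simp at he, by simp⟩, ?_⟩
    exact (fderiv_phaseSlope_reflectDir_pos hs0 hs1 he (by
      rintro rfl; have := hw.1; norm_num at this)).ne'
  obtain ⟨ε, hε, hsub⟩ := hK.exists_cthickening_subset_open hWo hKW
  refine ⟨W, hWo, (contDiffOn_phaseSlope s).mono Set.inter_subset_left, fun q hq => hq.2, ε, hε,
    ?_⟩
  rintro ⟨⟨w, r⟩, ξ⟩ ⟨⟨hw, hr⟩, hξ⟩
  refine hsub (Metric.mem_cthickening_of_dist_le _ ((w, 0), e) _ _ ⟨⟨hw, rfl⟩, rfl⟩ ?_)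
  rw [Prod.dist_eq, Prod.dist_eq]
  simp only [dist_self, Real.dist_eq, sub_zero]
  exact max_le (max_le hε.le (abs_le.2 hr)) hξ

/-- Bounds for the autocorrelation of `e^{i λ ‖ξ‖^s} χ(ξ)`, for a bump `χ` near `e`. -/
theorem exists_bump_autocorrelation {s : ℝ} (hs0 : 0 < s) (hs1 : s < 1) {e : E} (he : ‖e‖ = 1) :
    ∃ χ : E → ℝ, ContDiff ℝ ∞ χ ∧ (∀ ξ, 0 ≤ χ ξ) ∧ χ e = 1 ∧
      (∀ ξ, χ ξ ≠ 0 → ‖ξ - e‖ < 1 / 2) ∧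
      ∀ N : ℕ, ∃ C : ℝ, 0 ≤ C ∧ ∀ l : ℝ, 0 < l → ∀ η : E, η ≠ 0 →
        ‖∫ ξ, Complex.exp (Complex.I * ((l * (‖ξ + η‖ ^ s - ‖ξ‖ ^ s) : ℝ) : ℂ)) *
          (χ (ξ + η) * χ ξ)‖ ≤ C * ((l * ‖η‖) ^ N)⁻¹ := by
  obtain ⟨W, hWo, hΨ, hne, ε, hε, hsub⟩ := exists_isCompact_subset_nonstationary hs0 hs1 he
  -- If both bumps are nonzero then `|r| * ‖w‖ ≤ 2δ`, and `‖w‖ ≥ 1/2` gives `|r| ≤ 4δ ≤ ε`. The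
  -- bound `1/2` keeps the support away from the origin.
  set δ : ℝ := min (ε / 4) (1 / 2) with hδ
  have hδ0 : 0 < δ := by positivity
  have hδε : δ ≤ ε / 4 := min_le_left _ _
  let χ : ContDiffBump e := ⟨δ / 2, δ, by positivity, by linarith⟩
  -- Only unit vectors `w` are used in the end. The cutoff `κ (‖w‖ ^ 2)`, equal to `1` there, gives
  -- the amplitude compact support in the parameter too.
  let κ : ContDiffBump (1 : ℝ) := ⟨1 / 4, 1 / 2, by norm_num, by norm_num⟩
  have hχ : ∀ ξ, χ ξ ≠ 0 → ‖ξ - e‖ < δ := fun ξ h => by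
    have : ξ ∈ Function.support χ := h
    rw [χ.support_eq] at this
    simpa [dist_eq_norm] using this
  refine ⟨χ, χ.contDiff, fun ξ => χ.nonneg, χ.one_of_mem_closedBall
    (by simpa using χ.rIn_pos.le), fun ξ h => (hχ ξ h).trans_le (min_le_right _ _), fun N => ?_⟩
  set a : (E × ℝ) × E → ℂ := fun q =>
    ((κ (‖q.1.1‖ ^ 2) * (χ (q.2 + q.1.2 • q.1.1) * χ q.2) : ℝ) : ℂ) with ha
  have hac : ContDiff ℝ ∞ a := by
    refine Complex.ofRealCLM.contDiff.comp ?_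
    refine (κ.contDiff.comp ((contDiff_fst.comp contDiff_fst).norm_sq ℝ)).mul
      ((χ.contDiff.comp ?_).mul (χ.contDiff.comp contDiff_snd))
    exact contDiff_snd.add ((contDiff_snd.comp contDiff_fst).smul (contDiff_fst.comp contDiff_fst))
  set K : Set ((E × ℝ) × E) := ({w : E | 1 / 2 ≤ ‖w‖ ∧ ‖w‖ ≤ 2} ×ˢ Set.Icc (-ε) ε) ×ˢ
        Metric.closedBall e ε with hK
  have hann : IsCompact {w : E | 1 / 2 ≤ ‖w‖ ∧ ‖w‖ ≤ 2} := by
    refine (isCompact_closedBall (0 : E) 2).of_isClosed_subset ?_ fun w hw => by simpa using hw.2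
    exact (isClosed_le continuous_const continuous_norm).inter
      (isClosed_le continuous_norm continuous_const)
  have hKc : IsCompact K := (hann.prod isCompact_Icc).prod (isCompact_closedBall e ε)
  have haK : Function.support a ⊆ K := by
    rintro ⟨⟨w, r⟩, ξ⟩ hq
    simp only [ha, Function.mem_support, ne_eq, Complex.ofReal_eq_zero, mul_eq_zero, not_or] at hq
    obtain ⟨h1, h2, h3⟩ := hq
    have h1' : ‖w‖ ^ 2 ∈ Function.support κ := h1
    rw [κ.support_eq, Metric.mem_ball, Real.dist_eq, abs_lt] at h1'
    have h1a : 1 / 2 ≤ ‖w‖ := by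
      have : -(1 / 2) < ‖w‖ ^ 2 - 1 := h1'.1
      nlinarith [norm_nonneg w]
    have h1b : ‖w‖ ≤ 2 := by
      have : ‖w‖ ^ 2 - 1 < 1 / 2 := h1'.2
      nlinarith [norm_nonneg w]
    have h4 := hχ _ h2
    have h5 := hχ _ h3
    have h6 : |r| * ‖w‖ ≤ 2 * δ := by
      rw [← Real.norm_eq_abs, ← norm_smul]
      have : r • w = (ξ + r • w - e) - (ξ - e) := by abel
      rw [this]
      exact (norm_sub_le _ _).trans (by linarith)
    have h7 : |r| ≤ ε := by nlinarith [abs_nonneg r]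
    refine ⟨⟨⟨h1a, h1b⟩, abs_le.1 h7⟩, ?_⟩
    rw [Metric.mem_closedBall, dist_eq_norm]
    linarith
  have hasupp : HasCompactSupport a := HasCompactSupport.of_support_subset_isCompact hKc haK
  obtain ⟨C, hC⟩ := exists_norm_integral_exp_mul_le hWo hΨ
    (v := fun p : E × ℝ => reflectDir e p.1) ((contDiff_reflectDir e).comp contDiff_fst) hne N a
    hac hasupp ((closure_minimal haK hKc.isClosed).trans hsub)
  refine ⟨|C|, abs_nonneg C, fun l hl η hη => ?_⟩
  have hη' : 0 < ‖η‖ := norm_pos_iff.2 hη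
  refine le_trans ?_ ((hC (‖η‖⁻¹ • η, ‖η‖) (l * ‖η‖) (by positivity)).trans
    (mul_le_mul_of_nonneg_right (le_abs_self C) (by positivity)))
  refine le_of_eq (congrArg norm (integral_congr_ae (Filter.Eventually.of_forall fun ξ => ?_)))
  have hn1 : ‖‖η‖⁻¹ • η‖ = 1 := by rw [norm_smul, norm_inv, norm_norm, inv_mul_cancel₀ hη'.ne']
  have hκ : κ 1 = 1 := κ.one_of_mem_closedBall (by simpa using κ.rIn_pos.le)
  simp only [ha, hn1, one_pow, hκ, one_mul, smul_inv_smul₀ hη'.ne']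
  by_cases hξ : χ ξ = 0
  · simp [hξ]
  · have hξ0 : ξ ≠ 0 := by
      rintro rfl
      have := (hχ _ hξ).trans_le (min_le_right (ε / 4) (1 / 2))
      rw [zero_sub, norm_neg, he] at this
      norm_num at this
    have := mul_phaseSlope s ‖η‖ (‖η‖⁻¹ • η) hξ0
    rw [smul_inv_smul₀ hη'.ne'] at this
    rw [mul_assoc, this]
    push_cast
    rfl

theorem continuous_phase_mul {E : Type*} [NormedAddCommGroup E] [InnerProductSpace ℝ E]
    {s : ℝ} (hs0 : 0 < s) {χ : E → ℝ} (hχ : Continuous χ) (x : E) (l : ℝ) :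
    Continuous fun ξ : E =>
      Complex.exp (Complex.I * ((inner ℝ x ξ + l * ‖ξ‖ ^ s : ℝ) : ℂ)) * χ ξ := by
  have : Continuous fun ξ : E => ‖ξ‖ ^ s := continuous_norm.rpow_const fun _ => Or.inr hs0.le
  fun_prop

/-- The dispersive estimate for `e^{i λ ‖ξ‖^s}`, localised to a small ball. -/
theorem exists_bump_dispersive {s : ℝ} (hs0 : 0 < s) (hs1 : s < 1) {e : E} (he : ‖e‖ = 1) :
    ∃ χ : E → ℝ, ContDiff ℝ ∞ χ ∧ (∀ ξ, 0 ≤ χ ξ) ∧ χ e = 1 ∧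
      (∀ ξ, χ ξ ≠ 0 → ‖ξ - e‖ < 1 / 2) ∧
      ∃ C : ℝ, 0 < C ∧ ∀ l : ℝ, 0 < l → ∀ x : E,
        ‖∫ ξ, Complex.exp (Complex.I * ((inner ℝ x ξ + l * ‖ξ‖ ^ s : ℝ) : ℂ)) * χ ξ‖ ≤
          C * l ^ (-((Module.finrank ℝ E : ℝ) / 2)) := by
  obtain ⟨χ, hχc, hχ0, hχ1, hχs, hcorr⟩ := exists_bump_autocorrelation hs0 hs1 he
  refine ⟨χ, hχc, hχ0, hχ1, hχs, ?_⟩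
  set n := Module.finrank ℝ E with hn
  -- Order `0` controls small `l * ‖η‖`; order `n + 1` gives decay integrable in dimension `n`.
  -- Rescaling `η` by `l` then produces `l ^ (-n)`, and a square root the exponent `-n/2`.
  obtain ⟨C₀, hC₀, h0⟩ := hcorr 0
  obtain ⟨C₁, hC₁, h1⟩ := hcorr (n + 1)
  set A : ℝ := ∫ y : E, (1 + ‖y‖) ^ (-((n + 1 : ℕ) : ℝ)) with hA
  have hA0 : 0 ≤ A := integral_nonneg fun y => by positivity
  have hAi : Integrable (fun y : E => (1 + ‖y‖) ^ (-((n + 1 : ℕ) : ℝ))) :=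
    integrable_one_add_norm (by push_cast; linarith)
  set B : ℝ := 2 ^ (n + 1) * (C₀ + C₁) with hB
  have hB0 : 0 ≤ B := by positivity
  have hχsupp : HasCompactSupport χ := HasCompactSupport.intro (isCompact_closedBall e (1 / 2))
    fun ξ hξ => by
      by_contra h
      exact hξ (by simpa [dist_eq_norm] using (hχs ξ h).le)
  refine ⟨Real.sqrt (B * A) + 1, by positivity, fun l hl x => ?_⟩
  set u : E → ℂ := fun ξ =>
    Complex.exp (Complex.I * ((inner ℝ x ξ + l * ‖ξ‖ ^ s : ℝ) : ℂ)) * χ ξ with hu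
  have hus : HasCompactSupport u := by
    have : HasCompactSupport (fun ξ => (χ ξ : ℂ)) := hχsupp.comp_left Complex.ofReal_zero
    exact this.mul_left
  have hkey := norm_integral_sq_le_integral_norm_autocorrelation
    (continuous_phase_mul hs0 hχc.continuous x l) hus
  have hcor : ∀ η ξ : E, u (ξ + η) * (starRingEnd ℂ) (u ξ) =
      Complex.exp (Complex.I * (inner ℝ x η : ℝ)) *
      (Complex.exp (Complex.I * ((l * (‖ξ + η‖ ^ s - ‖ξ‖ ^ s) : ℝ) : ℂ)) * (χ (ξ + η) * χ ξ)) := by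
    intro η ξ
    simp only [hu, map_mul, ← Complex.exp_conj, Complex.conj_ofReal, Complex.conj_I]
    rw [show ∀ a b c d : ℂ, a * b * (c * d) = (a * c) * (b * d) by intros; ring, ← Complex.exp_add,
      ← mul_assoc (Complex.exp _) (Complex.exp _), ← Complex.exp_add]
    congr 2
    rw [inner_add_right]
    push_cast
    ring
  have hb : ∀ η : E, η ≠ 0 → ‖∫ ξ, u (ξ + η) * (starRingEnd ℂ) (u ξ)‖ ≤
      B * (1 + ‖l • η‖) ^ (-((n + 1 : ℕ) : ℝ)) := by
    intro η hη
    simp only [hcor]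
    rw [integral_const_mul, norm_mul, mul_comm Complex.I, Complex.norm_exp_ofReal_mul_I, one_mul,
      norm_smul, Real.norm_of_nonneg hl.le]
    have hη' : 0 < ‖η‖ := norm_pos_iff.2 hη
    exact le_mul_one_add_rpow_neg (n + 1) (by positivity) (by simpa using h0 l hl η hη)
      (h1 l hl η hη) hC₀ hC₁
  have hfin : ‖∫ ξ, u ξ‖ ^ 2 ≤ B * (A * (l ^ n)⁻¹) := by
    by_cases hE : ∃ y : E, y ≠ 0
    · have : Nontrivial E := ⟨hE.choose, 0, hE.choose_spec⟩
      refine hkey.trans ?_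
      have hcs := Measure.integral_comp_smul (volume : Measure E)
        (fun y : E => (1 + ‖y‖) ^ (-((n + 1 : ℕ) : ℝ))) l
      rw [smul_eq_mul, ← hn, abs_of_nonneg (by positivity)] at hcs
      rw [← hA, mul_comm _ A] at hcs
      rw [← hcs, ← integral_const_mul]
      refine integral_mono_of_nonneg (Filter.Eventually.of_forall fun _ => norm_nonneg _) ?_ ?_
      · exact (hAi.comp_smul hl.ne').const_mul B
      · have : ∀ᵐ η : E, η ≠ 0 := Measure.ae_ne volume 0
        filter_upwards [this] with η hη using hb η hη
    · exfalso
      exact hE ⟨e, by rintro rfl; simp at he⟩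
  have hl2 : (l ^ (-((n : ℝ) / 2))) ^ 2 = (l ^ n)⁻¹ := by
    rw [← Real.rpow_natCast (l ^ _) 2, ← Real.rpow_mul hl.le, ← Real.rpow_natCast l n,
      ← Real.rpow_neg hl.le]
    congr 1; push_cast; ring
  have hp : 0 < l ^ (-((n : ℝ) / 2)) := Real.rpow_pos_of_pos hl _
  rw [← mul_assoc, ← hl2, ← Real.sq_sqrt (by positivity : 0 ≤ B * A), ← mul_pow] at hfin
  exact (abs_le_of_sq_le_sq' hfin (by positivity)).2.trans
    (mul_le_mul_of_nonneg_right (by linarith) hp.le)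

end Dispersive

/-! ### Lower `L^1` bounds for the oscillatory kernel. -/

section Kernel

variable {E : Type*} [NormedAddCommGroup E]

/-- The amplitude `e^{i l ‖ξ‖^s} χ(ξ)`. -/
noncomputable def phaseBump (s : ℝ) (χ : E → ℝ) (l : ℝ) (ξ : E) : ℂ :=
  Complex.exp (Complex.I * ((l * ‖ξ‖ ^ s : ℝ) : ℂ)) * χ ξ

theorem norm_phaseBump (s : ℝ) (χ : E → ℝ) (l : ℝ) (ξ : E) : ‖phaseBump s χ l ξ‖ = |χ ξ| := by
  rw [phaseBump, norm_mul, mul_comm Complex.I, Complex.norm_exp_ofReal_mul_I, one_mul,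
    Complex.norm_real, Real.norm_eq_abs]

theorem tsupport_phaseBump_subset (s : ℝ) (χ : E → ℝ) (l : ℝ) :
    tsupport (phaseBump s χ l) ⊆ tsupport χ := closure_mono fun ξ h => by
  intro h0
  exact h (by simp [phaseBump, h0])

theorem hasCompactSupport_phaseBump (s : ℝ) {χ : E → ℝ} (hχ : HasCompactSupport χ) (l : ℝ) :
    HasCompactSupport (phaseBump s χ l) :=
  hχ.mono' (subset_closure.trans (tsupport_phaseBump_subset s χ l))

variable [InnerProductSpace ℝ E]

theorem contDiffAt_norm_rpow (s : ℝ) {ξ : E} (hξ : ξ ≠ 0) :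
    ContDiffAt ℝ ∞ (fun ξ : E => ‖ξ‖ ^ s) ξ :=
  (contDiffAt_norm ℝ hξ).rpow_const_of_ne (norm_ne_zero_iff.2 hξ)

theorem contDiff_phaseBump (s : ℝ) {χ : E → ℝ} (hχ : ContDiff ℝ ∞ χ) (h0 : (0 : E) ∉ tsupport χ)
    (l : ℝ) : ContDiff ℝ ∞ (phaseBump s χ l) :=
  contDiff_of_forall_mem_tsupport fun ξ hξ => by
    have hξ0 : ξ ≠ 0 := by rintro rfl; exact h0 (tsupport_phaseBump_subset s χ l hξ)
    have h1 : ContDiffAt ℝ ∞ (fun ξ : E => ((l * ‖ξ‖ ^ s : ℝ) : ℂ)) ξ :=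
      Complex.ofRealCLM.contDiff.contDiffAt.comp ξ
        (contDiffAt_const.mul (contDiffAt_norm_rpow s hξ0))
    exact (contDiffAt_const.mul h1).cexp.mul
      (Complex.ofRealCLM.contDiff.contDiffAt.comp ξ hχ.contDiffAt)

/-- Differentiating the phase costs one factor `l`. By Plancherel, this confines most of the
kernel's `L²` mass to a ball of radius comparable to `l`. -/
theorem exists_norm_fderiv_phaseBump_le (s : ℝ) {χ : E → ℝ} (hχ : ContDiff ℝ ∞ χ)
    (h0 : (0 : E) ∉ tsupport χ) (hc : HasCompactSupport χ) (v : E) :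
    ∃ G : E → ℝ, Continuous G ∧ HasCompactSupport G ∧
      ∀ l : ℝ, 1 ≤ l → ∀ ξ, ‖fderiv ℝ (phaseBump s χ l) ξ v‖ ≤ l * G ξ := by
  set P : E → ℝ := fun ξ => fderiv ℝ (fun ξ : E => ‖ξ‖ ^ s) ξ v * χ ξ with hP
  have hPs : tsupport P ⊆ tsupport χ := closure_mono fun ξ h => by
    intro hz
    exact h (by simp [hP, hz])
  have hPc : ContDiff ℝ ∞ P := contDiff_of_forall_mem_tsupport fun ξ hξ => by
    have hξ0 : ξ ≠ 0 := by rintro rfl; exact h0 (hPs hξ)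
    exact (((contDiffAt_norm_rpow s hξ0).fderiv_right (m := ∞) (by simp)).clm_apply
      contDiffAt_const).mul hχ.contDiffAt
  refine ⟨fun ξ => ‖P ξ‖ + ‖fderiv ℝ χ ξ v‖, ?_, ?_, fun l hl ξ => ?_⟩
  · exact hPc.continuous.norm.add
      ((hχ.continuous_fderiv (by simp)).clm_apply continuous_const).norm
  · exact (hc.mono' (subset_closure.trans hPs)).norm.add (hc.fderiv_apply ℝ v).norm
  · by_cases hξ : ξ ∈ tsupport χ
    · have hξ0 : ξ ≠ 0 := by rintro rfl; exact h0 hξ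
      have h1 : HasFDerivAt (fun ξ : E => Complex.exp (Complex.I * ((l * ‖ξ‖ ^ s : ℝ) : ℂ))) _ ξ :=
        ((Complex.ofRealCLM.hasFDerivAt.comp ξ
          (((contDiffAt_norm_rpow s hξ0).differentiableAt (by simp)).hasFDerivAt.const_mul
            l)).const_mul Complex.I).cexp
      have h2 : HasFDerivAt (fun ξ => (χ ξ : ℂ)) _ ξ :=
        Complex.ofRealCLM.hasFDerivAt.comp ξ (hχ.differentiable (by simp) ξ).hasFDerivAt
      have h3 := (h1.mul h2).fderiv
      have h4 : fderiv ℝ (phaseBump s χ l) ξ v =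
          Complex.exp (Complex.I * ((l * ‖ξ‖ ^ s : ℝ) : ℂ)) *
            (Complex.I * ((l * P ξ : ℝ) : ℂ) + ((fderiv ℝ χ ξ v : ℝ) : ℂ)) := by
        change fderiv ℝ (fun ξ : E => Complex.exp (Complex.I * ((l * ‖ξ‖ ^ s : ℝ) : ℂ)) * χ ξ) ξ v
          = _
        erw [h3]
        simp [hP]
        ring
      rw [h4, norm_mul, mul_comm Complex.I, Complex.norm_exp_ofReal_mul_I, one_mul]
      refine (norm_add_le _ _).trans ?_
      rw [norm_mul, Complex.norm_I, one_mul, Complex.norm_real, Complex.norm_real, norm_mul,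
        Real.norm_of_nonneg (by linarith : 0 ≤ l), mul_add]
      have := norm_nonneg (fderiv ℝ χ ξ v)
      nlinarith
    · have h1 : fderiv ℝ (phaseBump s χ l) ξ = 0 := by
        by_contra h
        exact hξ (tsupport_phaseBump_subset s χ l (tsupport_fderiv_subset ℝ (subset_closure h)))
      rw [h1]
      simp only [zero_apply, norm_zero]
      positivity

variable [FiniteDimensional ℝ E] [MeasurableSpace E] [BorelSpace E]

open FourierTransform LineDeriv

theorem integral_norm_sq_fourierInv (f : SchwartzMap E ℂ) :
    ∫ w, ‖(𝓕⁻ f : SchwartzMap E ℂ) w‖ ^ 2 = ∫ x, ‖f x‖ ^ 2 := by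
  rw [← SchwartzMap.integral_norm_sq_fourier, FourierTransform.fourier_fourierInv_eq]

theorem integrable_norm_sq_schwartz (f : SchwartzMap E ℂ) : Integrable fun x => ‖f x‖ ^ 2 := by
  simpa using (f.memLp 2).integrable_norm_pow (by simp)

theorem norm_fourierInv_lineDeriv_sq (f : SchwartzMap E ℂ) (v w : E) :
    ‖(𝓕⁻ (∂_{v} f) : SchwartzMap E ℂ) w‖ ^ 2 =
      (2 * Real.pi) ^ 2 * ((inner ℝ w v) ^ 2 * ‖(𝓕⁻ f : SchwartzMap E ℂ) w‖ ^ 2) := by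
  have h : (inner ℝ · v : E → ℝ).HasTemperateGrowth := by fun_prop
  rw [SchwartzMap.fourierInv_lineDerivOp_eq]
  simp only [smul_apply, SchwartzMap.smulLeftCLM_apply_apply h]
  rw [norm_smul, norm_smul, norm_neg]
  simp only [norm_mul, Complex.norm_I, Complex.norm_real, Complex.norm_ofNat, mul_one,
    Real.norm_eq_abs, mul_pow, sq_abs]

/-- The second moment of the inverse Fourier transform is controlled by the directional
derivatives. -/
theorem integral_norm_sq_mul_norm_sq_fourierInv (f : SchwartzMap E ℂ) :
    Integrable (fun w => ‖w‖ ^ 2 * ‖(𝓕⁻ f : SchwartzMap E ℂ) w‖ ^ 2) ∧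
    (2 * Real.pi) ^ 2 * ∫ w, ‖w‖ ^ 2 * ‖(𝓕⁻ f : SchwartzMap E ℂ) w‖ ^ 2 =
      ∑ i, ∫ ξ, ‖fderiv ℝ f ξ (stdOrthonormalBasis ℝ E i)‖ ^ 2 := by
  set b := stdOrthonormalBasis ℝ E
  have h1 : ∀ w : E, (2 * Real.pi) ^ 2 * (‖w‖ ^ 2 * ‖(𝓕⁻ f : SchwartzMap E ℂ) w‖ ^ 2) =
      ∑ i, ‖(𝓕⁻ (∂_{b i} f) : SchwartzMap E ℂ) w‖ ^ 2 := by
    intro w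
    simp only [norm_fourierInv_lineDeriv_sq]
    rw [← Finset.mul_sum, ← Finset.sum_mul, b.sum_sq_inner_left]
  have h2 : ∀ i, Integrable fun w => ‖(𝓕⁻ (∂_{b i} f) : SchwartzMap E ℂ) w‖ ^ 2 :=
    fun i => integrable_norm_sq_schwartz _
  have h3 : Integrable fun w => (2 * Real.pi) ^ 2 *
      (‖w‖ ^ 2 * ‖(𝓕⁻ f : SchwartzMap E ℂ) w‖ ^ 2) := by
    simp only [h1]
    exact integrable_finsetSum _ fun i _ => h2 i
  constructor
  · have := h3.const_mul ((2 * Real.pi) ^ 2)⁻¹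
    refine this.congr (Filter.Eventually.of_forall fun w => ?_)
    have : (2 * Real.pi) ^ 2 ≠ 0 := by positivity
    field_simp
  · rw [← integral_const_mul]
    simp only [h1]
    rw [integral_finsetSum _ fun i _ => h2 i]
    refine Finset.sum_congr rfl fun i _ => ?_
    rw [integral_norm_sq_fourierInv]
    rfl

/-- A function with `L²` norm bounded below, a small second moment and a small supremum has a large
`L¹` norm on a ball. -/
theorem setIntegral_norm_ge_of_moment {k : E → ℂ} (hk : Continuous k)
    (hk2 : Integrable fun w => ‖k w‖ ^ 2)
    (hkm : Integrable fun w => ‖w‖ ^ 2 * ‖k w‖ ^ 2) {M D S r : ℝ} (hr : 0 < r) (hS : 0 < S)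
    (hM : M ≤ ∫ w, ‖k w‖ ^ 2) (hD : ∫ w, ‖w‖ ^ 2 * ‖k w‖ ^ 2 ≤ D) (hDM : 2 * D ≤ M * r ^ 2)
    (hsup : ∀ w, ‖k w‖ ≤ S) :
    M / (2 * S) ≤ ∫ w in Metric.closedBall 0 r, ‖k w‖ := by
  set A : Set E := Metric.closedBall 0 r with hA
  have hAm : MeasurableSet A := measurableSet_closedBall
  have h1 := integral_add_compl hAm hk2
  -- Chebyshev: at most half of the `L²` mass lies outside the ball. Inside, `|k|² ≤ S |k|`.
  have h2 : r ^ 2 * ∫ w in Aᶜ, ‖k w‖ ^ 2 ≤ D := by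
    rw [← integral_const_mul]
    refine le_trans ?_ ((setIntegral_le_integral hkm
      (Filter.Eventually.of_forall fun w => by positivity) : ∫ w in Aᶜ, _ ≤ _).trans hD)
    refine setIntegral_mono_on (hk2.const_mul _).integrableOn hkm.integrableOn hAm.compl ?_
    intro w hw
    have : r < ‖w‖ := by simpa [hA] using hw
    gcongr
  have h3 : ∫ w in A, ‖k w‖ ^ 2 ≤ S * ∫ w in A, ‖k w‖ := by
    rw [← integral_const_mul]
    have hc : IsCompact A := isCompact_closedBall 0 r
    refine setIntegral_mono_on hk2.integrableOn
      ((hk.norm.continuousOn.integrableOn_compact hc).const_mul S) hAm fun w _ => ?_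
    rw [pow_two]
    exact mul_le_mul_of_nonneg_right (hsup w) (norm_nonneg _)
  rw [div_le_iff₀ (by positivity)]
  have h4 : ∫ w in Aᶜ, ‖k w‖ ^ 2 ≤ M / 2 := by
    have : 0 < r ^ 2 := by positivity
    by_contra h
    push Not at h
    nlinarith
  linarith

/-- The inverse Fourier integral `∫ e^{i y·ξ} u(ξ) dξ`, without normalising factor. -/
noncomputable def invTransform (u : E → ℂ) (y : E) : ℂ :=
  ∫ ξ, Complex.exp (Complex.I * (inner ℝ y ξ : ℝ)) * u ξ

theorem fourierInv_eq_invTransform (u : E → ℂ) (w : E) :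
    𝓕⁻ u w = invTransform u ((2 * Real.pi) • w) := by
  rw [Real.fourierInv_eq', invTransform]
  refine integral_congr_ae (Filter.Eventually.of_forall fun ξ => ?_)
  simp only [smul_eq_mul]
  congr 2
  rw [real_inner_smul_left, real_inner_comm w ξ]
  push_cast
  ring

/-- The `L²` norm does not depend on `l`, the second moment is `O(l²)` and the supremum is `O(l ^
(-γ))`. A small supremum with fixed `L²` mass forces a large `L^1` norm. -/
theorem exists_setIntegral_invTransform_phaseBump_ge (s : ℝ) {χ : E → ℝ} (hχ : ContDiff ℝ ∞ χ)
    (h0 : (0 : E) ∉ tsupport χ) (hc : HasCompactSupport χ) {e : E} (he : χ e ≠ 0) {C γ : ℝ}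
    (hC : 0 < C) (hdisp : ∀ l : ℝ, 0 < l → ∀ x, ‖invTransform (phaseBump s χ l) x‖ ≤ C * l ^ (-γ)) :
    ∃ B c : ℝ, 1 ≤ B ∧ 0 < c ∧ ∀ l : ℝ, 1 ≤ l →
      c * l ^ γ ≤ ∫ y in Metric.closedBall 0 (B * l), ‖invTransform (phaseBump s χ l) y‖ := by
  set b := stdOrthonormalBasis ℝ E
  choose G hGc hGs hG using fun i => exists_norm_fderiv_phaseBump_le s hχ h0 hc (b i)
  have hpi := Real.pi_pos
  set D : ℝ := ((2 * Real.pi) ^ 2)⁻¹ * ∑ i, ∫ ξ, G i ξ ^ 2 with hD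
  have hD0 : 0 ≤ D := mul_nonneg (by positivity)
    (Finset.sum_nonneg fun i _ => integral_nonneg fun _ => by positivity)
  set M : ℝ := ∫ ξ, |χ ξ| ^ 2 with hM
  have hM0 : 0 < M := by
    have h1 : Continuous fun ξ => |χ ξ| ^ 2 := by have := hχ.continuous; fun_prop
    have h2 : HasCompactSupport fun ξ => |χ ξ| ^ 2 :=
      hc.comp_left (g := fun t : ℝ => |t| ^ 2) (by simp)
    refine (integral_pos_iff_support_of_nonneg (fun _ => by positivity)
      (h1.integrable_of_hasCompactSupport h2)).2 ?_
    exact h1.isOpen_support.measure_pos _ ⟨e, by simpa using he⟩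
  -- Chosen so that `2D ≤ M B ≤ M B²`, the moment condition at radius `B * l`. The further factor
  -- `2π` below comes from the normalisation of `𝓕⁻`.
  set B : ℝ := 2 * D / M + 1 with hB
  have hB1 : 1 ≤ B := by rw [hB]; have : 0 ≤ 2 * D / M := by positivity
                         linarith
  refine ⟨2 * Real.pi * B, (2 * Real.pi) ^ Module.finrank ℝ E * (M / (2 * C)), ?_, by positivity,
    fun l hl => ?_⟩
  · have := Real.pi_gt_three
    nlinarith
  have hl0 : 0 < l := by linarith
  let f : SchwartzMap E ℂ := (hasCompactSupport_phaseBump s hc l).toSchwartzMap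
    (contDiff_phaseBump s hχ h0 l)
  have hf : (f : E → ℂ) = phaseBump s χ l := rfl
  have hkf : ∀ w, (𝓕⁻ f : SchwartzMap E ℂ) w =
      invTransform (phaseBump s χ l) ((2 * Real.pi) • w) := fun w => by
    rw [SchwartzMap.fourierInv_coe, fourierInv_eq_invTransform, hf]
  obtain ⟨hmi, hm⟩ := integral_norm_sq_mul_norm_sq_fourierInv f
  have hmD : ∫ w, ‖w‖ ^ 2 * ‖(𝓕⁻ f : SchwartzMap E ℂ) w‖ ^ 2 ≤ D * l ^ 2 := by
    have h1 : ∑ i, ∫ ξ, ‖fderiv ℝ f ξ (b i)‖ ^ 2 ≤ ∑ i, ∫ ξ, l ^ 2 * G i ξ ^ 2 := by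
      refine Finset.sum_le_sum fun i _ => ?_
      refine integral_mono (integrable_norm_sq_schwartz (∂_{b i} f)) ?_ fun ξ => ?_
      · refine Continuous.integrable_of_hasCompactSupport (by have := hGc i; fun_prop) ?_
        exact (hGs i).comp_left (g := fun t : ℝ => l ^ 2 * t ^ 2) (by simp)
      · change ‖fderiv ℝ (phaseBump s χ l) ξ (b i)‖ ^ 2 ≤ l ^ 2 * G i ξ ^ 2
        rw [← mul_pow]
        gcongr
        exact hG i l hl ξ
    rw [← hm] at h1
    simp only [integral_const_mul] at h1
    rw [← Finset.mul_sum] at h1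
    rw [hD]
    have h2 : 0 < (2 * Real.pi) ^ 2 := by positivity
    rw [mul_assoc, inv_mul_eq_div, le_div_iff₀ h2]
    linarith
  have key := setIntegral_norm_ge_of_moment (k := (𝓕⁻ f : SchwartzMap E ℂ))
    (SchwartzMap.continuous _) (integrable_norm_sq_schwartz _) hmi (M := M) (D := D * l ^ 2)
    (S := C * l ^ (-γ)) (r := B * l) (by positivity) (by positivity)
    (by rw [integral_norm_sq_fourierInv, hf]; simp only [norm_phaseBump]; exact le_rfl) hmD
    (by
      have h1 : 2 * D ≤ M * B := by rw [hB, mul_add, mul_div_cancel₀ _ hM0.ne']; linarith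
      have h2 : M * B ≤ M * B ^ 2 := by nlinarith
      nlinarith [sq_nonneg l])
    (fun w => by rw [hkf]; exact hdisp l hl0 _)
  simp only [hkf] at key
  rw [Measure.setIntegral_comp_smul_of_pos volume
    (fun y => ‖invTransform (phaseBump s χ l) y‖) (Metric.closedBall 0 (B * l))
    (by positivity : 0 < 2 * Real.pi), smul_closedBall _ _ (by positivity), smul_zero,
    Real.norm_of_nonneg (by positivity), smul_eq_mul, inv_mul_eq_div, le_div_iff₀ (by positivity)]
    at key
  rw [mul_assoc (2 * Real.pi)]
  refine le_trans (le_of_eq ?_) key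
  rw [Real.rpow_neg hl0.le]
  have : 0 < l ^ γ := Real.rpow_pos_of_pos hl0 _
  field_simp

end Kernel

section Euclidean

variable {n : ℕ}

local notation "𝔼" => EuclideanSpace ℝ (Fin n)

/-! ### Uniform local Hardy bounds for dilates. -/

section Hardy

open FourierTransform LineDeriv

theorem exists_norm_schwartz_le {V : Type*} [NormedAddCommGroup V] [NormedSpace ℝ V]
    (f : SchwartzMap V ℂ) (k : ℕ) : ∃ A : ℝ, 0 ≤ A ∧ ∀ x, ‖f x‖ ≤ A * ((1 + ‖x‖) ^ k)⁻¹ := by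
  refine ⟨2 ^ k * (Finset.Iic (k, 0)).sup (fun m => SchwartzMap.seminorm ℝ m.1 m.2) f,
    by positivity, fun x => ?_⟩
  have h := SchwartzMap.one_add_le_sup_seminorm_apply (𝕜 := ℝ) (m := (k, 0)) le_rfl le_rfl f x
  rw [norm_iteratedFDeriv_zero] at h
  rw [← div_eq_mul_inv, le_div_iff₀ (by positivity), mul_comm]
  exact h

theorem one_add_norm_le_mul {V : Type*} [SeminormedAddCommGroup V] (x y : V) :
    1 + ‖x‖ ≤ (1 + ‖x - y‖) * (1 + ‖y‖) := by
  have h := norm_le_norm_sub_add x y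
  nlinarith [norm_nonneg (x - y), norm_nonneg y, mul_nonneg (norm_nonneg (x - y)) (norm_nonneg y)]

theorem integrable_inv_one_add_norm_pow :
    Integrable (fun y : 𝔼 => ((1 + ‖y‖) ^ (n + 1))⁻¹) := by
  have h : Integrable (fun y : 𝔼 => (1 + ‖y‖) ^ (-((n + 1 : ℕ) : ℝ))) :=
    integrable_one_add_norm (by simp)
  refine h.congr (Filter.Eventually.of_forall fun y => ?_)
  simp only
  rw [Real.rpow_neg (by positivity), Real.rpow_natCast]

theorem norm_dilatedConv_le_of_le_one (Φ η : SchwartzMap 𝔼 ℂ) :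
    ∃ C : ℝ, 0 ≤ C ∧ ∀ t : ℝ, 0 < t → t ≤ 1 → ∀ x,
      ‖dilatedConv Φ η t x‖ ≤ C * ((1 + ‖x‖) ^ (n + 1))⁻¹ := by
  -- One half of the decay is traded for decay in `x`; the other half is integrated in `y`.
  obtain ⟨A, hA0, hA⟩ := exists_norm_schwartz_le Φ ((n + 1) + (n + 1))
  obtain ⟨H, hH0, hH⟩ := exists_norm_schwartz_le η (n + 1)
  set I : ℝ := ∫ y : 𝔼, ((1 + ‖y‖) ^ (n + 1))⁻¹ with hI
  have hI0 : 0 ≤ I := integral_nonneg fun y => by positivity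
  refine ⟨A * H * I, by positivity, fun t ht ht1 x => ?_⟩
  have hg : Integrable (fun z : 𝔼 => ((1 + ‖t⁻¹ • (x - z)‖) ^ (n + 1))⁻¹) :=
    (integrable_inv_one_add_norm_pow.comp_smul (inv_pos.2 ht).ne').comp_sub_left x
  have hgI : ∫ z : 𝔼, ((1 + ‖t⁻¹ • (x - z)‖) ^ (n + 1))⁻¹ = t ^ n * I := by
    rw [integral_sub_left_eq_self (fun z : 𝔼 => ((1 + ‖t⁻¹ • z‖) ^ (n + 1))⁻¹) volume x,
      Measure.integral_comp_smul volume (fun z : 𝔼 => ((1 + ‖z‖) ^ (n + 1))⁻¹) t⁻¹]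
    rw [finrank_euclideanSpace_fin, inv_pow, inv_inv, abs_of_pos (by positivity), smul_eq_mul]
  have hb : ∀ y, ‖(((t ^ n)⁻¹ : ℝ) : ℂ) * Φ (t⁻¹ • (x - y)) * η y‖ ≤
      (t ^ n)⁻¹ * (A * H * ((1 + ‖x‖) ^ (n + 1))⁻¹) * ((1 + ‖t⁻¹ • (x - y)‖) ^ (n + 1))⁻¹ := by
    intro y
    rw [norm_mul, norm_mul, Complex.norm_real, Real.norm_of_nonneg (by positivity)]
    set p := ‖t⁻¹ • (x - y)‖ with hp
    have hp0 : 0 ≤ p := norm_nonneg _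
    have h1 : ‖x - y‖ ≤ p := by
      rw [hp, norm_smul, Real.norm_of_nonneg (by positivity)]
      exact le_mul_of_one_le_left (norm_nonneg _) ((one_le_inv₀ ht).2 ht1)
    have h2 : 1 + ‖x‖ ≤ (1 + p) * (1 + ‖y‖) :=
      (one_add_norm_le_mul x y).trans (by gcongr)
    have h3 : ((1 + p) ^ (n + 1))⁻¹ * ((1 + ‖y‖) ^ (n + 1))⁻¹ ≤ ((1 + ‖x‖) ^ (n + 1))⁻¹ := by
      rw [← mul_inv, ← mul_pow]
      gcongr
    calc (t ^ n)⁻¹ * ‖Φ (t⁻¹ • (x - y))‖ * ‖η y‖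
        ≤ (t ^ n)⁻¹ * (A * ((1 + p) ^ ((n + 1) + (n + 1)))⁻¹) *
          (H * ((1 + ‖y‖) ^ (n + 1))⁻¹) := by
          gcongr
          · exact hA _
          · exact hH y
      _ = (t ^ n)⁻¹ * (A * H) * (((1 + p) ^ (n + 1))⁻¹ * ((1 + ‖y‖) ^ (n + 1))⁻¹) *
          ((1 + p) ^ (n + 1))⁻¹ := by rw [pow_add, mul_inv]; ring
      _ ≤ (t ^ n)⁻¹ * (A * H) * ((1 + ‖x‖) ^ (n + 1))⁻¹ * ((1 + p) ^ (n + 1))⁻¹ := by gcongr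
      _ = _ := by ring
  refine (norm_integral_le_of_norm_le (hg.const_mul _) (Filter.Eventually.of_forall hb)).trans
    (le_of_eq ?_)
  rw [integral_const_mul, hgI]
  field_simp

/-- Moving the derivative onto `Φ` gains `t⁻¹`. The resulting `t ^ (-(n+1))` is exactly what turns
decay in `(x - y)/t` into decay in `x - y`, uniformly in `t ≥ 1`. -/
theorem norm_dilatedConv_lineDeriv_le_of_one_le (Φ ζ : SchwartzMap 𝔼 ℂ) (v : 𝔼) :
    ∃ C : ℝ, 0 ≤ C ∧ ∀ t : ℝ, 1 ≤ t → ∀ x,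
      ‖dilatedConv Φ (∂_{v} ζ : SchwartzMap 𝔼 ℂ) t x‖ ≤ C * ((1 + ‖x‖) ^ (n + 1))⁻¹ := by
  obtain ⟨A, hA0, hA⟩ := exists_norm_schwartz_le (∂_{v} Φ : SchwartzMap 𝔼 ℂ) (n + 1)
  obtain ⟨A', hA'0, hA'⟩ := exists_norm_schwartz_le Φ 0
  obtain ⟨Z, hZ0, hZ⟩ := exists_norm_schwartz_le ζ ((n + 1) + (n + 1))
  set I : ℝ := ∫ y : 𝔼, ((1 + ‖y‖) ^ (n + 1))⁻¹ with hI
  have hI0 : 0 ≤ I := integral_nonneg fun y => by positivity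
  refine ⟨A * Z * I, by positivity, fun t ht x => ?_⟩
  have ht0 : 0 < t := by linarith
  have hΦd : ∀ y : 𝔼, HasFDerivAt (fun y : 𝔼 => Φ (t⁻¹ • (x - y)))
      ((fderiv ℝ Φ (t⁻¹ • (x - y))).comp (t⁻¹ • (-ContinuousLinearMap.id ℝ 𝔼))) y := fun y =>
    (Φ.hasFDerivAt (t⁻¹ • (x - y))).comp y (((hasFDerivAt_id y).const_sub x).const_smul t⁻¹)
  have hΦv : ∀ y : 𝔼, fderiv ℝ (fun y : 𝔼 => Φ (t⁻¹ • (x - y))) y v =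
      -((t⁻¹ : ℝ) : ℂ) * (∂_{v} Φ : SchwartzMap 𝔼 ℂ) (t⁻¹ • (x - y)) := fun y => by
    rw [(hΦd y).fderiv, SchwartzMap.lineDerivOp_apply_eq_fderiv]
    simp
  have hcΦ : Continuous fun y : 𝔼 => Φ (t⁻¹ • (x - y)) := Φ.continuous.comp (by fun_prop)
  have hcΦ' : Continuous fun y : 𝔼 => (∂_{v} Φ : SchwartzMap 𝔼 ℂ) (t⁻¹ • (x - y)) :=
    (SchwartzMap.continuous _).comp (by fun_prop)
  have hbd : ∀ y : 𝔼, ‖Φ (t⁻¹ • (x - y))‖ ≤ A' := fun y => by simpa using hA' (t⁻¹ • (x - y))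
  have hbd' : ∀ y : 𝔼, ‖(∂_{v} Φ : SchwartzMap 𝔼 ℂ) (t⁻¹ • (x - y))‖ ≤ A := fun y =>
    (hA _).trans (mul_le_of_le_one_right hA0 (inv_le_one_of_one_le₀ (one_le_pow₀ (by simp))))
  have hparts : ∫ y, Φ (t⁻¹ • (x - y)) * (∂_{v} ζ : SchwartzMap 𝔼 ℂ) y =
      ((t⁻¹ : ℝ) : ℂ) * ∫ y, (∂_{v} Φ : SchwartzMap 𝔼 ℂ) (t⁻¹ • (x - y)) * ζ y := by
    have h := integral_mul_fderiv_eq_neg_fderiv_mul_of_integrable (μ := (volume : Measure 𝔼))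
      (𝕜 := ℂ) (f := fun y : 𝔼 => Φ (t⁻¹ • (x - y))) (g := ζ) (v := v) ?_ ?_ ?_ ?_ ?_
    · rw [← integral_const_mul]
      simp only [SchwartzMap.lineDerivOp_apply_eq_fderiv] at h ⊢
      rw [h, ← integral_neg]
      refine integral_congr_ae (Filter.Eventually.of_forall fun y => ?_)
      simp only [hΦv, SchwartzMap.lineDerivOp_apply_eq_fderiv]
      ring
    · simp only [hΦv, mul_assoc]
      exact (ζ.integrable.bdd_mul hcΦ'.aestronglyMeasurable
        (Filter.Eventually.of_forall hbd')).const_mul _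
    · exact (∂_{v} ζ : SchwartzMap 𝔼 ℂ).integrable.bdd_mul hcΦ.aestronglyMeasurable
        (Filter.Eventually.of_forall hbd)
    · exact ζ.integrable.bdd_mul hcΦ.aestronglyMeasurable (Filter.Eventually.of_forall hbd)
    · exact fun y _ => (hΦd y).differentiableAt
    · exact fun y _ => ζ.differentiableAt
  have heq : dilatedConv Φ (∂_{v} ζ : SchwartzMap 𝔼 ℂ) t x =
      ∫ y, (((t ^ (n + 1))⁻¹ : ℝ) : ℂ) * ((∂_{v} Φ : SchwartzMap 𝔼 ℂ) (t⁻¹ • (x - y)) * ζ y) := by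
    simp only [dilatedConv, mul_assoc]
    rw [integral_const_mul, hparts, integral_const_mul, ← mul_assoc, ← Complex.ofReal_mul,
      ← mul_inv, ← pow_succ]
  have hb : ∀ y, ‖(((t ^ (n + 1))⁻¹ : ℝ) : ℂ) *
      ((∂_{v} Φ : SchwartzMap 𝔼 ℂ) (t⁻¹ • (x - y)) * ζ y)‖ ≤
      A * Z * ((1 + ‖x‖) ^ (n + 1))⁻¹ * ((1 + ‖y‖) ^ (n + 1))⁻¹ := by
    intro y
    rw [norm_mul, norm_mul, Complex.norm_real, Real.norm_of_nonneg (by positivity)]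
    have h1 : (t ^ (n + 1))⁻¹ * ((1 + ‖t⁻¹ • (x - y)‖) ^ (n + 1))⁻¹ ≤
        ((1 + ‖x - y‖) ^ (n + 1))⁻¹ := by
      rw [← mul_inv, ← mul_pow]
      gcongr
      rw [norm_smul, Real.norm_of_nonneg (by positivity), mul_add,
        mul_inv_cancel_left₀ ht0.ne', mul_one]
      linarith
    have h3 : ((1 + ‖x - y‖) ^ (n + 1))⁻¹ * ((1 + ‖y‖) ^ (n + 1))⁻¹ ≤
        ((1 + ‖x‖) ^ (n + 1))⁻¹ := by
      rw [← mul_inv, ← mul_pow]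
      gcongr
      exact one_add_norm_le_mul x y
    calc (t ^ (n + 1))⁻¹ * (‖(∂_{v} Φ : SchwartzMap 𝔼 ℂ) (t⁻¹ • (x - y))‖ * ‖ζ y‖)
        ≤ (t ^ (n + 1))⁻¹ * ((A * ((1 + ‖t⁻¹ • (x - y)‖) ^ (n + 1))⁻¹) *
          (Z * ((1 + ‖y‖) ^ ((n + 1) + (n + 1)))⁻¹)) := by
          gcongr
          · exact hA _
          · exact hZ y
      _ = A * Z * ((t ^ (n + 1))⁻¹ * ((1 + ‖t⁻¹ • (x - y)‖) ^ (n + 1))⁻¹ *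
          ((1 + ‖y‖) ^ (n + 1))⁻¹) * ((1 + ‖y‖) ^ (n + 1))⁻¹ := by
          rw [pow_add (1 + ‖y‖), mul_inv ((1 + ‖y‖) ^ (n + 1))]; ring
      _ ≤ A * Z * (((1 + ‖x - y‖) ^ (n + 1))⁻¹ * ((1 + ‖y‖) ^ (n + 1))⁻¹) *
          ((1 + ‖y‖) ^ (n + 1))⁻¹ := by gcongr
      _ ≤ _ := by gcongr
  rw [heq]
  refine (norm_integral_le_of_norm_le (integrable_inv_one_add_norm_pow.const_mul _)
    (Filter.Eventually.of_forall hb)).trans (le_of_eq ?_)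
  rw [integral_const_mul]
  ring

theorem dilatedConv_dilate (Φ η : 𝔼 → ℂ) {R : ℝ} (hR : 0 < R) {t : ℝ} (ht : 0 < t) (x : 𝔼) :
    dilatedConv Φ (fun y => ((R ^ n : ℝ) : ℂ) * η (R • y)) t x =
      ((R ^ n : ℝ) : ℂ) * dilatedConv Φ η (t * R) (R • x) := by
  have h := Measure.integral_comp_smul (volume : Measure 𝔼)
    (fun z : 𝔼 => (((t * R) ^ n)⁻¹ : ℝ) * Φ ((t * R)⁻¹ • (R • x - z)) * η z) R
  rw [finrank_euclideanSpace_fin, abs_of_pos (by positivity)] at h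
  have hR' : (R : ℂ) ≠ 0 := by exact_mod_cast hR.ne'
  have h2 : (∫ z : 𝔼, (((t * R) ^ n)⁻¹ : ℝ) * Φ ((t * R)⁻¹ • (R • x - z)) * η z) =
      ((R ^ n : ℝ) : ℂ) * ∫ y : 𝔼, (((t * R) ^ n)⁻¹ : ℝ) *
        Φ ((t * R)⁻¹ • (R • x - R • y)) * η (R • y) := by
    rw [h, Complex.real_smul]
    push_cast
    field_simp
  rw [dilatedConv, dilatedConv, h2, ← integral_const_mul, ← integral_const_mul]
  refine integral_congr_ae (Filter.Eventually.of_forall fun y => ?_)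
  simp only
  rw [← smul_sub, smul_smul, show (t * R)⁻¹ * R = t⁻¹ by field_simp, mul_pow]
  push_cast
  field_simp

/-- The local Hardy norm of the `L¹`-normalised dilates of `∂_v ζ` is bounded. -/
theorem exists_localHardyNorm_dilate_le (Φ ζ : SchwartzMap 𝔼 ℂ) (v : 𝔼) :
    ∃ C : ℝ, 0 ≤ C ∧ ∀ R : ℝ, 0 < R →
      localHardyNorm Φ (fun y => ((R ^ n : ℝ) : ℂ) * (∂_{v} ζ : SchwartzMap 𝔼 ℂ) (R • y)) ≤
        ENNReal.ofReal C := by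
  obtain ⟨C₀, hC₀, h0⟩ := norm_dilatedConv_le_of_le_one Φ (∂_{v} ζ)
  obtain ⟨C₁, hC₁, h1⟩ := norm_dilatedConv_lineDeriv_le_of_one_le Φ ζ v
  set I : ℝ := ∫ y : 𝔼, ((1 + ‖y‖) ^ (n + 1))⁻¹ with hI
  have hI0 : 0 ≤ I := integral_nonneg fun y => by positivity
  refine ⟨(C₀ + C₁) * I, by positivity, fun R hR => ?_⟩
  -- After rescaling, the parameter is `t * R`, which ranges over `(0, R)`. A bound uniform in `R`
  -- therefore needs all positive scales, and large ones need the cancellation of a derivative.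
  have hb : ∀ t : ℝ, 0 < t → ∀ x : 𝔼, ‖dilatedConv Φ (∂_{v} ζ : SchwartzMap 𝔼 ℂ) t x‖ ≤
      (C₀ + C₁) * ((1 + ‖x‖) ^ (n + 1))⁻¹ := by
    intro t ht x
    have hp : 0 ≤ ((1 + ‖x‖) ^ (n + 1))⁻¹ := by positivity
    rcases le_total t 1 with h | h
    · exact (h0 t ht h x).trans (mul_le_mul_of_nonneg_right (by linarith) hp)
    · exact (h1 t h x).trans (mul_le_mul_of_nonneg_right (by linarith) hp)
  set g : 𝔼 → ℝ := fun x => R ^ n * (C₀ + C₁) * ((1 + ‖R • x‖) ^ (n + 1))⁻¹ with hg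
  have hgi : Integrable g := (integrable_inv_one_add_norm_pow.comp_smul hR.ne').const_mul _
  have hgI : ∫ x, g x = (C₀ + C₁) * I := by
    rw [hg, integral_const_mul,
      Measure.integral_comp_smul volume (fun z : 𝔼 => ((1 + ‖z‖) ^ (n + 1))⁻¹) R,
      finrank_euclideanSpace_fin, abs_of_pos (by positivity), smul_eq_mul, ← hI]
    field_simp
  rw [← hgI, ofReal_integral_eq_lintegral_ofReal hgi
    (Filter.Eventually.of_forall fun x => by positivity)]
  refine lintegral_mono fun x => iSup₂_le fun t ht => ?_
  rw [dilatedConv_dilate Φ _ hR ht.1, ← ofReal_norm]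
  refine ENNReal.ofReal_le_ofReal ?_
  rw [norm_mul, Complex.norm_real, Real.norm_of_nonneg (by positivity), hg]
  have := hb (t * R) (mul_pos ht.1 hR) (R • x)
  calc _ ≤ R ^ n * ((C₀ + C₁) * ((1 + ‖R • x‖) ^ (n + 1))⁻¹) := by gcongr
    _ = _ := by ring

end Hardy

/-! ### Frequency-localised test functions and their images. -/

section TestFunctions

open FourierTransform LineDeriv

theorem multiplierOp_eq_invTransform (a f : 𝔼 → ℂ) (x : 𝔼) :
    multiplierOp a f x =
      ((2 * (Real.pi : ℂ)) ^ n)⁻¹ * invTransform (fun ξ => a ξ * fourierHat f ξ) x := by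
  simp only [multiplierOp, invTransform, mul_assoc]

theorem invTransform_dilate (u : 𝔼 → ℂ) {r : ℝ} (hr : 0 < r) (x : 𝔼) :
    invTransform (fun ξ => u (r⁻¹ • ξ)) x = ((r ^ n : ℝ) : ℂ) * invTransform u (r • x) := by
  have h := Measure.integral_comp_smul (volume : Measure 𝔼)
    (fun ξ => Complex.exp (Complex.I * (inner ℝ (r • x) ξ : ℝ)) * u ξ) r⁻¹
  rw [finrank_euclideanSpace_fin, abs_of_pos (by positivity), inv_pow, inv_inv,
    Complex.real_smul] at h
  rw [invTransform, invTransform, ← h]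
  refine integral_congr_ae (Filter.Eventually.of_forall fun ξ => ?_)
  simp only
  rw [inner_smul_left, inner_smul_right]
  simp [hr.ne']

/-- Every smooth compactly supported function is the Fourier transform of a Schwartz function. -/
theorem exists_schwartz_fourierHat_eq {v : 𝔼 → ℂ} (hv : ContDiff ℝ ∞ v)
    (hc : HasCompactSupport v) :
    ∃ f : SchwartzMap 𝔼 ℂ, (∀ x, f x = ((2 * (Real.pi : ℂ)) ^ n)⁻¹ * invTransform v x) ∧
      ∀ ξ, fourierHat f ξ = v ξ := by
  have hpi : 0 < 2 * Real.pi := by positivity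
  have hc' : HasCompactSupport fun ξ => v ((2 * Real.pi) • ξ) := hc.comp_smul hpi.ne'
  have hv' : ContDiff ℝ ∞ fun ξ => v ((2 * Real.pi) • ξ) := hv.comp (contDiff_const_smul _)
  let g : SchwartzMap 𝔼 ℂ := hc'.toSchwartzMap hv'
  have hg : (g : 𝔼 → ℂ) = fun ξ => v ((2 * Real.pi) • ξ) := rfl
  refine ⟨𝓕⁻ g, fun x => ?_, fun ξ => ?_⟩
  · rw [SchwartzMap.fourierInv_coe, fourierInv_eq_invTransform, hg]
    have h := invTransform_dilate v (inv_pos.2 hpi) ((2 * Real.pi) • x)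
    rw [inv_inv, inv_smul_smul₀ hpi.ne'] at h
    rw [h]
    push_cast
    rw [inv_pow]
  · have h1 : fourierHat (𝓕⁻ g : SchwartzMap 𝔼 ℂ) ξ =
        (𝓕 (𝓕⁻ g : SchwartzMap 𝔼 ℂ) : SchwartzMap 𝔼 ℂ) ((2 * Real.pi)⁻¹ • ξ) := by
      rw [SchwartzMap.fourier_coe, Real.fourier_eq', fourierHat]
      refine integral_congr_ae (Filter.Eventually.of_forall fun x => ?_)
      simp only [smul_eq_mul]
      congr 2
      rw [inner_smul_right, real_inner_comm]
      have : (Real.pi : ℂ) ≠ 0 := by exact_mod_cast Real.pi_ne_zero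
      push_cast
      field_simp
    rw [h1, FourierTransform.fourier_fourierInv_eq, hg]
    simp only [smul_inv_smul₀ hpi.ne']

/-- By homogeneity, at frequency scale `r` the operator advances the time `l` by `r ^ s`. -/
theorem phase_mul_phaseBump (s : ℝ) (χ : 𝔼 → ℝ) (l : ℝ) {r : ℝ} (hr : 0 < r) (ξ : 𝔼) :
    phase s ξ * phaseBump s χ l (r⁻¹ • ξ) = phaseBump s χ (l + r ^ s) (r⁻¹ • ξ) := by
  rw [phase, phaseBump, phaseBump, ← mul_assoc, ← Complex.exp_add]
  congr 2
  rw [norm_smul, norm_inv, Real.norm_of_nonneg hr.le, Real.mul_rpow (by positivity) (norm_nonneg _),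
    Real.inv_rpow hr.le]
  have : r ^ s ≠ 0 := (Real.rpow_pos_of_pos hr s).ne'
  have h : (l + r ^ s) * ((r ^ s)⁻¹ * ‖ξ‖ ^ s) = ‖ξ‖ ^ s + l * ((r ^ s)⁻¹ * ‖ξ‖ ^ s) := by
    field_simp
    ring
  rw [h]
  push_cast
  ring

/-- The symbol matters only where the dilated bump is nonzero, so the same packet serves with or
without a dyadic cutoff. -/
theorem exists_test_function (s : ℝ) {χ : 𝔼 → ℝ} (hχ : ContDiff ℝ ∞ χ)
    (h0 : (0 : 𝔼) ∉ tsupport χ) (hc : HasCompactSupport χ) (l : ℝ) {r : ℝ} (hr : 0 < r) :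
    ∃ f : SchwartzMap 𝔼 ℂ,
      (∀ x, f x = ((2 * (Real.pi : ℂ)) ^ n)⁻¹ *
        (((r ^ n : ℝ) : ℂ) * invTransform (phaseBump s χ l) (r • x))) ∧
      ∀ a : 𝔼 → ℂ, (∀ ξ, χ (r⁻¹ • ξ) ≠ 0 → a ξ = phase s ξ) →
        ∀ x, multiplierOp a f x = ((2 * (Real.pi : ℂ)) ^ n)⁻¹ *
          (((r ^ n : ℝ) : ℂ) * invTransform (phaseBump s χ (l + r ^ s)) (r • x)) := by
  obtain ⟨f, hf, hfhat⟩ := exists_schwartz_fourierHat_eq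
    (v := fun ξ => phaseBump s χ l (r⁻¹ • ξ))
    ((contDiff_phaseBump s hχ h0 l).comp (contDiff_const_smul _))
    ((hasCompactSupport_phaseBump s hc l).comp_smul (inv_pos.2 hr).ne')
  refine ⟨f, fun x => ?_, fun a ha x => ?_⟩
  · rw [hf, invTransform_dilate _ hr]
  · rw [multiplierOp_eq_invTransform, ← invTransform_dilate _ hr]
    congr 2
    funext ξ
    rw [hfhat, ← phase_mul_phaseBump s χ l hr]
    by_cases h : χ (r⁻¹ • ξ) = 0
    · simp [phaseBump, h]
    · rw [ha ξ h]

/-- A bump supported in an open half space is the Fourier transform of a directional derivative. -/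
theorem exists_lineDeriv_eq_invTransform {v : 𝔼 → ℂ} (hv : ContDiff ℝ ∞ v)
    (hc : HasCompactSupport v) {e : 𝔼} (he : ∀ ξ ∈ tsupport v, inner ℝ ξ e ≠ (0 : ℝ)) :
    ∃ ζ : SchwartzMap 𝔼 ℂ, ∀ x, (∂_{e} ζ : SchwartzMap 𝔼 ℂ) x =
      ((2 * (Real.pi : ℂ)) ^ n)⁻¹ * invTransform v x := by
  -- Differentiation along `e` multiplies by `i ξ·e`, which may be divided out as it does not vanish
  -- on the support.
  set w : 𝔼 → ℂ := fun ξ => v ξ * (Complex.I * (inner ℝ ξ e : ℝ))⁻¹ with hw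
  have hws : tsupport w ⊆ tsupport v := closure_mono fun ξ h hz => h (by simp [hw, hz])
  have hwc : ContDiff ℝ ∞ w := contDiff_of_forall_mem_tsupport fun ξ hξ => by
    have h1 : ContDiff ℝ ∞ fun ξ : 𝔼 => ((inner ℝ ξ e : ℝ) : ℂ) :=
      Complex.ofRealCLM.contDiff.comp (contDiff_id.inner ℝ contDiff_const)
    exact hv.contDiffAt.mul ((contDiffAt_const.mul h1.contDiffAt).inv
      (by simpa using he ξ (hws hξ)))
  have hpi : 0 < 2 * Real.pi := by positivity
  have hcs : HasCompactSupport fun ξ => w ((2 * Real.pi) • ξ) :=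
    HasCompactSupport.comp_smul (hc.mono' (subset_closure.trans hws)) hpi.ne'
  let g : SchwartzMap 𝔼 ℂ := hcs.toSchwartzMap (hwc.comp (contDiff_const_smul _))
  have hg : ∀ ξ, g ξ = w ((2 * Real.pi) • ξ) := fun _ => rfl
  refine ⟨𝓕⁻ g, fun x => ?_⟩
  have ht : (inner ℝ · e : 𝔼 → ℝ).HasTemperateGrowth := by fun_prop
  have hmul : ((2 * (Real.pi : ℂ) * Complex.I) •
      SchwartzMap.smulLeftCLM ℂ (inner ℝ · e : 𝔼 → ℝ) g : SchwartzMap 𝔼 ℂ) =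
      fun ξ => v ((2 * Real.pi) • ξ) := by
    funext ξ
    rw [smul_apply, SchwartzMap.smulLeftCLM_apply_apply ht, hg, hw]
    simp only [real_inner_smul_left]
    by_cases h : v ((2 * Real.pi) • ξ) = 0
    · simp [h]
    · have h1 := he _ (subset_closure h)
      rw [real_inner_smul_left] at h1
      have h2 : (inner ℝ ξ e : ℝ) ≠ 0 := right_ne_zero_of_mul h1
      have h3 : ((inner ℝ ξ e : ℝ) : ℂ) ≠ 0 := by exact_mod_cast h2
      have h4 : (Real.pi : ℂ) ≠ 0 := by exact_mod_cast Real.pi_ne_zero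
      rw [Complex.real_smul, smul_eq_mul]
      push_cast
      field_simp
  rw [SchwartzMap.lineDerivOp_fourierInv_eq, SchwartzMap.fourierInv_coe, hmul,
    fourierInv_eq_invTransform]
  have h := invTransform_dilate v (inv_pos.2 hpi) ((2 * Real.pi) • x)
  rw [inv_inv, inv_smul_smul₀ hpi.ne'] at h
  rw [h]
  push_cast
  rw [inv_pow]

/-- Complex conjugation reverses time, `χ` being real. This carries the dispersive bound to the
negative times of `f`. -/
theorem norm_invTransform_neg_phaseBump (s : ℝ) (χ : 𝔼 → ℝ) (l : ℝ) (x : 𝔼) :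
    ‖invTransform (phaseBump s χ (-l)) x‖ = ‖invTransform (phaseBump s χ l) (-x)‖ := by
  rw [← Complex.norm_conj (invTransform (phaseBump s χ l) (-x)), invTransform, invTransform,
    ← integral_conj]
  congr 1
  refine integral_congr_ae (Filter.Eventually.of_forall fun ξ => ?_)
  simp only [phaseBump, map_mul, ← Complex.exp_conj, Complex.conj_ofReal, Complex.conj_I,
    inner_neg_left]
  push_cast
  ring_nf

theorem invTransform_phaseBump (s : ℝ) (χ : 𝔼 → ℝ) (l : ℝ) (x : 𝔼) :
    invTransform (phaseBump s χ l) x =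
      ∫ ξ, Complex.exp (Complex.I * ((inner ℝ x ξ + l * ‖ξ‖ ^ s : ℝ) : ℂ)) * χ ξ := by
  rw [invTransform]
  refine integral_congr_ae (Filter.Eventually.of_forall fun ξ => ?_)
  simp only [phaseBump]
  rw [← mul_assoc, ← Complex.exp_add]
  push_cast
  ring_nf

/-- No cancellation occurs near the focus: `|x·ξ| ≤ 1` on the support, so `cos (x·ξ) ≥ 1/2`. -/
theorem integral_div_two_le_norm_invTransform (s : ℝ) {χ : 𝔼 → ℝ} (hχ : Continuous χ)
    (hc : HasCompactSupport χ) (hpos : ∀ ξ, 0 ≤ χ ξ) (hsupp : ∀ ξ, χ ξ ≠ 0 → ‖ξ‖ ≤ 2) {x : 𝔼}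
    (hx : ‖x‖ ≤ 1 / 2) :
    (∫ ξ, χ ξ) / 2 ≤ ‖invTransform (phaseBump s χ 0) x‖ := by
  have hint : Integrable fun ξ : 𝔼 =>
      Complex.exp (Complex.I * (inner ℝ x ξ : ℝ)) * phaseBump s χ 0 ξ := by
    refine Continuous.integrable_of_hasCompactSupport ?_
      (hasCompactSupport_phaseBump s hc 0).mul_left
    simp only [phaseBump, zero_mul]
    fun_prop
  refine le_trans ?_ (Complex.re_le_norm _)
  refine le_trans ?_ (le_of_eq (integral_re hint))
  rw [← integral_div]
  refine integral_mono ((hχ.integrable_of_hasCompactSupport hc).div_const 2) hint.re fun ξ => ?_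
  have h1 : (Complex.exp (Complex.I * (inner ℝ x ξ : ℝ)) * phaseBump s χ 0 ξ).re =
      Real.cos (inner ℝ x ξ) * χ ξ := by
    rw [phaseBump, mul_comm Complex.I, Complex.exp_mul_I]
    simp [← Complex.ofReal_cos, ← Complex.ofReal_sin]
  change χ ξ / 2 ≤ (Complex.exp (Complex.I * (inner ℝ x ξ : ℝ)) * phaseBump s χ 0 ξ).re
  rw [h1]
  by_cases h : χ ξ = 0
  · simp [h]
  · have h2 : |inner ℝ x ξ| ≤ 1 := (abs_real_inner_le_norm x ξ).trans (by
      have := hsupp ξ h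
      nlinarith [norm_nonneg x, norm_nonneg ξ])
    have h3 := Real.one_sub_sq_div_two_le_cos (x := inner ℝ x ξ)
    have h4 : (inner ℝ x ξ) ^ 2 ≤ (1 : ℝ) := (sq_le_one_iff_abs_le_one _).2 h2
    have := hpos ξ
    nlinarith

end TestFunctions

theorem nonpos_of_forall_two_pow_rpow_le {a D : ℝ} (h : ∀ j : ℕ, 1 ≤ j → ((2 : ℝ) ^ j) ^ a ≤ D) :
    a ≤ 0 := by
  by_contra ha
  push Not at ha
  have h1 : 1 < (2 : ℝ) ^ a := Real.one_lt_rpow one_lt_two ha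
  obtain ⟨j, hj⟩ := pow_unbounded_of_one_lt D h1
  have h2 := h (j + 1) (by omega)
  rw [← Real.rpow_natCast, ← Real.rpow_mul two_pos.le, mul_comm, Real.rpow_mul two_pos.le,
    Real.rpow_natCast] at h2
  have h3 : ((2 : ℝ) ^ a) ^ j ≤ ((2 : ℝ) ^ a) ^ (j + 1) := pow_le_pow_right₀ h1.le (by omega)
  linarith

/-! ### Lower bound for the product, and the bump used throughout. -/

section Lower

/-- Lower bound for the `L¹` norm of a product of test functions concentrated at scales `r⁻¹`,
`r⁻¹` and `R⁻¹`. -/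
theorem ofReal_le_eLpNorm_product {F K : 𝔼 → ℂ} (hK : Continuous K) {P c₀ r R : ℝ} (hP : 0 ≤ P)
    (hc₀ : 0 ≤ c₀) (hr : 0 < r) (hR : 0 < R) (hF : ∀ x : 𝔼, ‖x‖ ≤ 1 / 2 → c₀ ≤ ‖F x‖)
    {f g h : 𝔼 → ℂ} (hf : ∀ x, ‖f x‖ = P * (r ^ n * ‖F (r • x)‖))
    (hg : ∀ x, ‖g x‖ = P * (r ^ n * ‖F (r • x)‖)) (hh : ∀ x, ‖h x‖ = P * (R ^ n * ‖K (R • x)‖)) :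
    ENNReal.ofReal (P ^ 3 * (r ^ n) ^ 2 * c₀ ^ 2 *
      ∫ y in Metric.closedBall 0 (R * (1 / (2 * r))), ‖K y‖) ≤
      eLpNorm (fun x => f x * g x * h x) 1 volume := by
  set A : Set 𝔼 := Metric.closedBall 0 (1 / (2 * r)) with hA
  have hAc : IsCompact A := isCompact_closedBall _ _
  have hint : ∫ y in Metric.closedBall 0 (R * (1 / (2 * r))), ‖K y‖ =
      ∫ x in A, R ^ n * ‖K (R • x)‖ := by
    rw [integral_const_mul, Measure.setIntegral_comp_smul_of_pos volume (fun y => ‖K y‖) A hR,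
      finrank_euclideanSpace_fin, hA, smul_closedBall _ _ (by positivity), smul_zero,
      Real.norm_of_nonneg hR.le, smul_eq_mul]
    field_simp
  rw [hint, ← integral_const_mul, ofReal_integral_eq_lintegral_ofReal
    (ContinuousOn.integrableOn_compact hAc (by fun_prop))
    (Filter.Eventually.of_forall fun x => by positivity), eLpNorm_one_eq_lintegral_enorm]
  refine le_trans (setLIntegral_mono' measurableSet_closedBall fun x hx => ?_)
    (setLIntegral_le_lintegral A _)
  rw [← ofReal_norm, norm_mul, norm_mul, hf, hg, hh]
  refine ENNReal.ofReal_le_ofReal ?_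
  have h1 : c₀ ≤ ‖F (r • x)‖ := by
    refine hF _ ?_
    rw [norm_smul, Real.norm_of_nonneg hr.le]
    have : ‖x‖ ≤ 1 / (2 * r) := by simpa [hA] using hx
    calc r * ‖x‖ ≤ r * (1 / (2 * r)) := by gcongr
      _ = 1 / 2 := by field_simp
  calc P ^ 3 * (r ^ n) ^ 2 * c₀ ^ 2 * (R ^ n * ‖K (R • x)‖)
      ≤ P ^ 3 * (r ^ n) ^ 2 * ‖F (r • x)‖ ^ 2 * (R ^ n * ‖K (R • x)‖) := by gcongr
    _ = _ := by ring

theorem eLpNorm_top_le_ofReal {f : 𝔼 → ℂ} {a : ℝ} (hf : ∀ x, ‖f x‖ ≤ a) :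
    eLpNorm f ⊤ volume ≤ ENNReal.ofReal a := by
  rw [eLpNorm_exponent_top]
  exact eLpNormEssSup_le_of_ae_bound (Filter.Eventually.of_forall hf)

theorem continuous_invTransform {u : 𝔼 → ℂ} (hu : ContDiff ℝ ∞ u) (hc : HasCompactSupport u) :
    Continuous (invTransform u) := by
  obtain ⟨f, hf, -⟩ := exists_schwartz_fourierHat_eq hu hc
  have hpi : ((2 * (Real.pi : ℂ)) ^ n) ≠ 0 := by
    have : (Real.pi : ℂ) ≠ 0 := by exact_mod_cast Real.pi_ne_zero
    exact pow_ne_zero _ (mul_ne_zero two_ne_zero this)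
  have : invTransform u = fun x => (2 * (Real.pi : ℂ)) ^ n * f x := by
    funext x
    rw [hf, mul_inv_cancel_left₀ hpi]
  rw [this]
  exact continuous_const.mul f.continuous

/-- A bump near a unit vector together with all the estimates for its oscillatory transforms. -/
theorem exists_bump_estimates (hn : 0 < n) {s : ℝ} (hs0 : 0 < s) (hs1 : s < 1) :
    ∃ χ : 𝔼 → ℝ, ContDiff ℝ ∞ χ ∧ HasCompactSupport χ ∧ (0 : 𝔼) ∉ tsupport χ ∧
      (∀ ξ, χ ξ ≠ 0 → 1 / 2 ≤ ‖ξ‖ ∧ ‖ξ‖ ≤ 3 / 2) ∧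
      (∃ e : 𝔼, ∀ ξ ∈ tsupport χ, inner ℝ ξ e ≠ (0 : ℝ)) ∧
      (∃ c₀ : ℝ, 0 < c₀ ∧ ∀ x, ‖x‖ ≤ 1 / 2 → c₀ ≤ ‖invTransform (phaseBump s χ 0) x‖) ∧
      (∃ C : ℝ, 0 < C ∧ ∀ l : ℝ, 0 < l → ∀ x,
        ‖invTransform (phaseBump s χ (-l)) x‖ ≤ C * l ^ (-((n : ℝ) / 2))) ∧
      ∃ B c : ℝ, 1 ≤ B ∧ 0 < c ∧ ∀ l : ℝ, 1 ≤ l → c * l ^ ((n : ℝ) / 2) ≤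
        ∫ y in Metric.closedBall 0 (B * l), ‖invTransform (phaseBump s χ l) y‖ := by
  set e : 𝔼 := EuclideanSpace.single ⟨0, hn⟩ 1 with he
  have he1 : ‖e‖ = 1 := by simp [he]
  obtain ⟨χ, hχ, hpos, hχe, hsupp, C, hC, hdisp⟩ := exists_bump_dispersive hs0 hs1 he1
  rw [finrank_euclideanSpace_fin] at hdisp
  simp only [← invTransform_phaseBump] at hdisp
  have hts : tsupport χ ⊆ Metric.closedBall e (1 / 2) :=
    closure_minimal (fun ξ h => by simpa [dist_eq_norm] using (hsupp ξ h).le)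
      Metric.isClosed_closedBall
  have hc : HasCompactSupport χ := HasCompactSupport.of_support_subset_isCompact
    (isCompact_closedBall e (1 / 2)) (subset_closure.trans hts)
  have h0 : (0 : 𝔼) ∉ tsupport χ := fun h => by
    have := hts h
    rw [Metric.mem_closedBall, dist_eq_norm, zero_sub, norm_neg, he1] at this
    norm_num at this
  have hnorm : ∀ ξ, χ ξ ≠ 0 → 1 / 2 ≤ ‖ξ‖ ∧ ‖ξ‖ ≤ 3 / 2 := fun ξ h => by
    have h1 := hsupp ξ h
    have h2 := norm_sub_norm_le ξ e
    have h3 := norm_sub_norm_le e ξ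
    rw [norm_sub_rev e ξ] at h3
    constructor <;> linarith
  refine ⟨χ, hχ, hc, h0, hnorm, ⟨e, fun ξ hξ => ?_⟩, ⟨(∫ ξ, χ ξ) / 2, ?_, fun x hx => ?_⟩,
    ⟨C, hC, fun l hl x => ?_⟩, exists_setIntegral_invTransform_phaseBump_ge s hχ h0 hc
      (by rw [hχe]; exact one_ne_zero) hC hdisp⟩
  · have h1 : ‖ξ - e‖ ≤ 1 / 2 := by simpa [dist_eq_norm] using hts hξ
    have h2 := abs_real_inner_le_norm (ξ - e) e
    rw [inner_sub_left, real_inner_self_eq_norm_sq, he1] at h2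
    have h3 := (abs_le.1 h2).1
    intro h4
    rw [h4] at h3
    linarith
  · refine half_pos ((integral_pos_iff_support_of_nonneg hpos
      (hχ.continuous.integrable_of_hasCompactSupport hc)).2 ?_)
    exact hχ.continuous.isOpen_support.measure_pos _ ⟨e, by simp [hχe]⟩
  · exact integral_div_two_le_norm_invTransform s hχ.continuous hc hpos
      (fun ξ h => (hnorm ξ h).2.trans (by norm_num)) hx
  · rw [norm_invTransform_neg_phaseBump]
    exact hdisp l hl _

end Lower

end Euclidean

end OscillatoryMultiplier

/-! ### Choice of scales and comparison of powers. -/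

theorem proposition4p1 {n : ℕ} (hn : 0 < n) {s : ℝ} (hs0 : 0 < s) (hs1 : s < 1) (m : ℝ)
    -- the two fixed cut-off functions
    (θ φ : EuclideanSpace ℝ (Fin n) → ℂ)
    (hθ : ContDiff ℝ ∞ θ)
    (hθ_one : ∀ ξ, 1 / 8 ≤ ‖ξ‖ → ‖ξ‖ ≤ 8 → θ ξ = 1)
    (hθ_supp : tsupport θ ⊆ {ξ | 1 / 10 ≤ ‖ξ‖ ∧ ‖ξ‖ ≤ 10})
    (hφ : ContDiff ℝ ∞ φ)
    (hφ_one : ∀ ξ, ‖ξ‖ ≤ 2 → φ ξ = 1)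
    (hφ_supp : tsupport φ ⊆ {ξ | ‖ξ‖ ≤ 3})
    -- the function through which the norm of `h^1` is defined
    (Φ : SchwartzMap (EuclideanSpace ℝ (Fin n)) ℂ) (hΦ : (∫ x, Φ x) ≠ 0)
    -- the trilinear estimate, uniformly in the positive integer `j`
    (hest : ∃ c : ℝ≥0, ∀ j : ℕ, 1 ≤ j →
      ∀ f g h : SchwartzMap (EuclideanSpace ℝ (Fin n)) ℂ,
        ENNReal.ofReal ((2 : ℝ) ^ ((j : ℝ) * m)) *
          eLpNorm (fun x =>
            OscillatoryMultiplier.multiplierOp (OscillatoryMultiplier.phase s) f x *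
            OscillatoryMultiplier.multiplierOp
              (fun ξ => OscillatoryMultiplier.phase s ξ *
                OscillatoryMultiplier.dyadicDilate j φ ξ) g x *
            OscillatoryMultiplier.multiplierOp
              (fun ξ => OscillatoryMultiplier.phase s ξ *
                OscillatoryMultiplier.dyadicDilate j θ ξ) h x) 1 volume
        ≤ (c : ℝ≥0∞) * eLpNorm f ⊤ volume * eLpNorm g ⊤ volume *
            OscillatoryMultiplier.localHardyNorm Φ h) :
    m ≤ -((n : ℝ) * s / 2) - (n : ℝ) * s * (1 - s) := by
  obtain ⟨c, hc⟩ := hest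
  obtain ⟨χ, hχ, hχc, h0, hsupp, ⟨e, he⟩, ⟨c₀, hc₀, hlow⟩, ⟨C, hC, hdisp⟩, B, b, hB, hb, hker⟩ :=
    OscillatoryMultiplier.exists_bump_estimates (n := n) hn hs0 hs1
  obtain ⟨ζ, hζ⟩ := OscillatoryMultiplier.exists_lineDeriv_eq_invTransform
    (OscillatoryMultiplier.contDiff_phaseBump s hχ h0 0)
    (OscillatoryMultiplier.hasCompactSupport_phaseBump s hχc 0)
    (fun ξ hξ => he ξ (OscillatoryMultiplier.tsupport_phaseBump_subset s χ 0 hξ))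
  obtain ⟨H, hH, hHardy⟩ := OscillatoryMultiplier.exists_localHardyNorm_dilate_le Φ ζ e
  set P : ℝ := ((2 * Real.pi) ^ n)⁻¹ with hP
  have hP0 : 0 < P := by positivity
  have hPn : ‖((2 * (Real.pi : ℂ)) ^ n)⁻¹‖ = P := by
    rw [norm_inv, norm_pow, norm_mul, Complex.norm_real, Complex.norm_ofNat,
      Real.norm_of_nonneg Real.pi_pos.le]
  have hpow : ∀ t : ℝ, 0 < t → ∀ z : ℂ, ‖((2 * (Real.pi : ℂ)) ^ n)⁻¹ * (((t ^ n : ℝ) : ℂ) * z)‖ =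
      P * (t ^ n * ‖z‖) := fun t ht z => by
    rw [norm_mul, norm_mul, hPn, Complex.norm_real, Real.norm_of_nonneg (by positivity)]
  set D : ℝ := c * P ^ 2 * C ^ 2 * H / (P ^ 3 * c₀ ^ 2 * b) * (2 * B) ^ (s * n) with hD
  suffices h : ∀ j : ℕ, 1 ≤ j →
      ((2 : ℝ) ^ j) ^ (m + s * (n / 2) + (1 - s) * (s * n)) ≤ D by
    have := OscillatoryMultiplier.nonpos_of_forall_two_pow_rpow_le h
    nlinarith
  intro j hj
  set R : ℝ := (2 : ℝ) ^ j with hR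
  have hR1 : 1 ≤ R := one_le_pow₀ one_le_two
  have hR0 : 0 < R := by linarith
  -- This gives `R / (2r) = B * R ^ s`: in rescaled variables, the ball where `f` focuses is the one
  -- on which the kernel at time `R ^ s` has its large `L^1` norm.
  set r : ℝ := R ^ (1 - s) / (2 * B) with hr
  have hr0 : 0 < r := div_pos (Real.rpow_pos_of_pos hR0 _) (by linarith)
  have hrR : r ≤ R := by
    have h1 : R ^ (1 - s) ≤ R ^ (1 : ℝ) := Real.rpow_le_rpow_of_exponent_le hR1 (by linarith)
    rw [Real.rpow_one] at h1
    exact (div_le_self (Real.rpow_nonneg hR0.le _) (by linarith)).trans h1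
  obtain ⟨f, hf, hfm⟩ :=
    -- Starting at time `-(r ^ s)`, the packet reaches time `0`, its focus, under `e^{i|D|^s}`.
    OscillatoryMultiplier.exists_test_function s hχ h0 hχc (-r ^ s) hr0
  obtain ⟨h, hh, hhm⟩ := OscillatoryMultiplier.exists_test_function s hχ h0 hχc 0 hR0
  have hdil : ∀ t : ℝ, 0 < t → ∀ ξ : EuclideanSpace ℝ (Fin n), χ (t⁻¹ • ξ) ≠ 0 →
      t / 2 ≤ ‖ξ‖ ∧ ‖ξ‖ ≤ 3 / 2 * t := fun t ht ξ hξ => by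
    have h1 := hsupp _ hξ
    rw [norm_smul, norm_inv, Real.norm_of_nonneg ht.le, inv_mul_eq_div, le_div_iff₀ ht,
      div_le_iff₀ ht] at h1
    exact ⟨by linarith [h1.1], h1.2⟩
  have hcut : ∀ ξ : EuclideanSpace ℝ (Fin n), ‖((2 : ℝ) ^ j)⁻¹ • ξ‖ = ‖ξ‖ / R := fun ξ => by
    rw [norm_smul, norm_inv, Real.norm_of_nonneg hR0.le, inv_mul_eq_div]
  have hF := hfm (OscillatoryMultiplier.phase s) fun _ _ => rfl
  -- Since `r ≤ R`, the frequencies are at most `3R/2`, where the low-frequency cutoff equals `1`.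
  -- Those of `h` lie between `R/2` and `3R/2`, where `θ(2^{-j}ξ) = 1`.
  have hG := hfm (fun ξ => OscillatoryMultiplier.phase s ξ *
      OscillatoryMultiplier.dyadicDilate j φ ξ) fun ξ hξ => by
    have h1 := hdil r hr0 ξ hξ
    rw [OscillatoryMultiplier.dyadicDilate, hφ_one, mul_one]
    rw [hcut, div_le_iff₀ hR0]
    linarith
  have hK := hhm (fun ξ => OscillatoryMultiplier.phase s ξ *
      OscillatoryMultiplier.dyadicDilate j θ ξ) fun ξ hξ => by
    have h1 := hdil R hR0 ξ hξ
    rw [OscillatoryMultiplier.dyadicDilate, hθ_one, mul_one]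
    · rw [hcut, le_div_iff₀ hR0]
      linarith
    · rw [hcut, div_le_iff₀ hR0]
      linarith
  rw [neg_add_cancel] at hF hG
  rw [zero_add] at hK
  have hlower := OscillatoryMultiplier.ofReal_le_eLpNorm_product
    (F := OscillatoryMultiplier.invTransform (OscillatoryMultiplier.phaseBump s χ 0))
    (OscillatoryMultiplier.continuous_invTransform
      (OscillatoryMultiplier.contDiff_phaseBump s hχ h0 (R ^ s))
      (OscillatoryMultiplier.hasCompactSupport_phaseBump s hχc (R ^ s)))
    hP0.le hc₀.le hr0 hR0 hlow (fun x => (congrArg norm (hF x)).trans (hpow r hr0 _))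
    (fun x => (congrArg norm (hG x)).trans (hpow r hr0 _))
    (fun x => (congrArg norm (hK x)).trans (hpow R hR0 _))
  have hRs : 1 ≤ R ^ s := Real.one_le_rpow hR1 hs0.le
  have hrad : R * (1 / (2 * r)) = B * R ^ s := by
    have h1 : R ^ (1 - s) * R ^ s = R := by
      rw [← Real.rpow_add hR0, sub_add_cancel, Real.rpow_one]
    have h2 : R ^ (1 - s) ≠ 0 := (Real.rpow_pos_of_pos hR0 _).ne'
    have h3 : B ≠ 0 := by linarith
    rw [hr]
    field_simp
    linarith
  rw [hrad] at hlower
  have hfsup : eLpNorm f ⊤ volume ≤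
      ENNReal.ofReal (P * (r ^ n * (C * (r ^ s) ^ (-((n : ℝ) / 2))))) := by
    refine OscillatoryMultiplier.eLpNorm_top_le_ofReal fun x => ?_
    rw [hf, hpow r hr0]
    have := hdisp (r ^ s) (Real.rpow_pos_of_pos hr0 _) (r • x)
    gcongr
  have hhH : OscillatoryMultiplier.localHardyNorm Φ h ≤ ENNReal.ofReal H := by
    refine le_trans (le_of_eq ?_) (hHardy R hR0)
    congr 1
    funext x
    rw [hh, hζ]
    ring
  have hmain := hc j hj f f h
  have hup : (c : ℝ≥0∞) * eLpNorm f ⊤ volume * eLpNorm f ⊤ volume *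
      OscillatoryMultiplier.localHardyNorm Φ h ≤
      ENNReal.ofReal (c * (P * (r ^ n * (C * (r ^ s) ^ (-((n : ℝ) / 2))))) *
        (P * (r ^ n * (C * (r ^ s) ^ (-((n : ℝ) / 2))))) * H) := by
    rw [ENNReal.ofReal_mul (by positivity), ENNReal.ofReal_mul (by positivity),
      ENNReal.ofReal_mul (by positivity), ENNReal.ofReal_coe_nnreal]
    gcongr
  have hreal := (mul_le_mul_right hlower (ENNReal.ofReal ((2 : ℝ) ^ ((j : ℝ) * m)))).trans
    (hmain.trans hup)
  rw [← ENNReal.ofReal_mul (by positivity), ENNReal.ofReal_le_ofReal_iff (by positivity)] at hreal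
  have hjm : (2 : ℝ) ^ ((j : ℝ) * m) = R ^ m := by
    rw [Real.rpow_mul two_pos.le, Real.rpow_natCast]
  have hkerR := hker (R ^ s) hRs
  -- The square reflects the choice `g = f`: two dispersive gains of `r ^ (-sn/2)`.
  have hrs : ((r ^ s) ^ (-((n : ℝ) / 2))) ^ 2 = (r ^ (s * n))⁻¹ := by
    rw [← Real.rpow_natCast, ← Real.rpow_mul hr0.le, ← Real.rpow_mul hr0.le,
      ← Real.rpow_neg hr0.le]
    congr 1
    push_cast
    ring
  have hrsn : 0 < r ^ (s * n) := Real.rpow_pos_of_pos hr0 _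
  have hrsn' : r ^ (s * n) * (2 * B) ^ (s * n) = R ^ ((1 - s) * (s * n)) := by
    rw [← Real.mul_rpow hr0.le (by linarith), hr, div_mul_cancel₀ _ (by linarith),
      ← Real.rpow_mul hR0.le]
  have hRm : 0 < R ^ m := Real.rpow_pos_of_pos hR0 _
  have h1 : R ^ m * (P ^ 3 * (r ^ n) ^ 2 * c₀ ^ 2 * (b * (R ^ s) ^ ((n : ℝ) / 2))) ≤
      c * P ^ 2 * (r ^ n) ^ 2 * C ^ 2 * (r ^ (s * n))⁻¹ * H := by
    rw [hjm] at hreal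
    calc _ ≤ _ := by gcongr
      _ ≤ _ := hreal
      _ = c * P ^ 2 * (r ^ n) ^ 2 * C ^ 2 * ((r ^ s) ^ (-((n : ℝ) / 2))) ^ 2 * H := by ring
      _ = _ := by rw [hrs]
  have h2 : R ^ m * (R ^ s) ^ ((n : ℝ) / 2) * r ^ (s * n) ≤
      c * P ^ 2 * C ^ 2 * H / (P ^ 3 * c₀ ^ 2 * b) := by
    rw [le_div_iff₀ (by positivity)]
    have h3 : 0 < (r ^ n) ^ 2 := by positivity
    refine le_of_mul_le_mul_right ?_ h3
    calc R ^ m * (R ^ s) ^ ((n : ℝ) / 2) * r ^ (s * n) * (P ^ 3 * c₀ ^ 2 * b) * (r ^ n) ^ 2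
        = R ^ m * (P ^ 3 * (r ^ n) ^ 2 * c₀ ^ 2 * (b * (R ^ s) ^ ((n : ℝ) / 2))) *
          r ^ (s * n) := by ring
      _ ≤ c * P ^ 2 * (r ^ n) ^ 2 * C ^ 2 * (r ^ (s * n))⁻¹ * H * r ^ (s * n) := by gcongr
      _ = _ := by field_simp
  rw [Real.rpow_add hR0, Real.rpow_add hR0, Real.rpow_mul hR0.le s, ← hrsn', ← mul_assoc, hD]
  exact mul_le_mul_of_nonneg_right h2 (Real.rpow_nonneg (by linarith) _)
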